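/- Let $0<s<1$, $T>0$, $a=1-2s$, and let $k:\mathbb R\to\mathbb R$ be measurable, bounded and $T$-periodic. Consider $Lu:=(-\partial_{xx})^s u+k(x)u$, where $(-\partial_{xx})^s$ is the Fourier multiplier with symbol $|\xi|^{2s}$. Let $L^2_T$ be the space of (a.e. classes of) real $T$-periodic functions on $\mathbb R$ that are square integrable over a period, with $\langle u,v\rangle=\int_{-T/2}^{T/2}uv\,dx$. Let $\mathcal H_T$ be the space of functions $U(x,y)$ on $\{y>0\}$ that are $T$-periodic in $x$, integrable on $(-T/2,T/2)\times(0,R)$ for every $R>0$, and have a weak gradient $\nabla U$ and a trace $U(\cdot,0)$ with $$\int_{-T/2}^{T/2}\int_0^\infty y^{a}|\nabla U|^2\,dy\,dx+\int_{-T/2}^{T/2}U(x,0)^2\,dx<\infty .$$ Here weak gradient and trace are meant in the sense of Green's formula against smooth functions on $\mathbb R^2$ that are $T$-periodic in $x$ and vanish for large $y$ (not necessarily for $y$ near $0$). For $U,V\in\mathcal H_T$ put $$B(U,V)=d_s\int_{-T/2}^{T/2}\int_0^\infty y^{a}\,\nabla U\cdot\nabla V\,dy\,dx+\int_{-T/2}^{T/2}k(x)U(x,0)V(x,0)\,dx,\qquad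 d_s=2^{2s-1}\frac{\Gamma(s)}{\Gamma(1-s)}.$$ For $g\in L^2_T$, a weak periodic solution of $Lu=g$ is a function $u\in L^2_T$ that is the trace $u=U(\cdot,0)$ of some $U\in\mathcal H_T$ with $B(U,V)=\langle g,V(\cdot,0)\rangle$ for all $V\in\mathcal H_T$. **Theorem (Fredholm alternative).** Exactly one of the following holds: (i) for each $g\in L^2_T$ there exists a unique weak periodic solution $u$ of $Lu=g$; (ii) there exists a weak periodic solution $u\not\equiv 0$ of $Lu=0$. Furthermore, the set $\mathcal N\subset L^2_T$ of weak periodic solutions of $Lu=0$ is a finite-dimensional linear subspace, and, for each $g\in L^2_T$, the equation $Lu=g$ has a weak periodic solution if and only if $\langle g,v\rangle=0$ for all $v\in\mathcal N$. -/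

import Mathlib

open MeasureTheory Set
open scoped ContDiff

namespace PeriodicFracLap

/-- One period `(-T/2, T/2]` of the line. -/
def period (T : ℝ) : Set ℝ := Ioc (-(T / 2)) (T / 2)

/-- One period `(-T/2, T/2] × (0, ∞)` of the upper half-plane. -/
def strip (T : ℝ) : Set (ℝ × ℝ) := period T ×ˢ Ioi (0 : ℝ)

/-- The space `L²_T`: (classes modulo a.e. equality of) `T`-periodic real functions on the line
that are square integrable over one period. -/
def L2T (T : ℝ) : Submodule ℝ (ℝ →ₘ[(volume : Measure ℝ)] ℝ) where
  carrier := {u | (∀ᵐ x : ℝ, u (x + T) = u x) ∧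
    MemLp (fun x : ℝ => u x) 2 (volume.restrict (period T))}
  zero_mem' := by
    have h0 : ∀ᵐ x : ℝ, (0 : ℝ →ₘ[(volume : Measure ℝ)] ℝ) x = 0 := AEEqFun.coeFn_zero
    have h1 := (measurePreserving_add_right (volume : Measure ℝ) T).quasiMeasurePreserving.ae h0
    refine ⟨?_, ?_⟩
    · filter_upwards [h0, h1] with x hx hx'
      rw [hx, hx']
    · exact (memLp_congr_ae (ae_restrict_of_ae h0)).2 (MemLp.zero' (ε := ℝ))
  add_mem' := by
    rintro u v ⟨hu, hu'⟩ ⟨hv, hv'⟩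
    have h0 : ∀ᵐ x : ℝ, (u + v) x = u x + v x := AEEqFun.coeFn_add u v
    have h1 := (measurePreserving_add_right (volume : Measure ℝ) T).quasiMeasurePreserving.ae h0
    refine ⟨?_, ?_⟩
    · filter_upwards [h0, h1, hu, hv] with x hx hx' h2 h3
      rw [hx, hx', h2, h3]
    · exact (memLp_congr_ae (ae_restrict_of_ae h0)).2 (hu'.add hv')
  smul_mem' := by
    rintro c u ⟨hu, hu'⟩
    have h0 : ∀ᵐ x : ℝ, (c • u) x = c * u x := AEEqFun.coeFn_smul c u
    have h1 := (measurePreserving_add_right (volume : Measure ℝ) T).quasiMeasurePreserving.ae h0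
    refine ⟨?_, ?_⟩
    · filter_upwards [h0, h1, hu] with x hx hx' h2
      rw [hx, hx', h2]
    · exact (memLp_congr_ae (ae_restrict_of_ae h0)).2 (hu'.const_mul c)

/-- The pairing `⟨u, v⟩ = ∫_{-T/2}^{T/2} u v dx` of `L²_T`. -/
noncomputable def pairing {T : ℝ} (u v : L2T T) : ℝ :=
  ∫ x in period T, (u : ℝ →ₘ[(volume : Measure ℝ)] ℝ) x * (v : ℝ →ₘ[(volume : Measure ℝ)] ℝ) x

/-- Test functions on the closed half-plane `y ≥ 0`: smooth, `T`-periodic in `x`, and vanishing for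
large `y` (not necessarily near `y = 0`). -/
structure IsTest (T : ℝ) (φ : ℝ × ℝ → ℝ) : Prop where
  smooth : ContDiff ℝ ∞ φ
  periodic : ∀ x y : ℝ, φ (x + T, y) = φ (x, y)
  vanishes : ∃ R : ℝ, ∀ x y : ℝ, R ≤ y → φ (x, y) = 0

/-- The space `𝓗_T` of functions `U(x, y)` on the half-plane `y > 0`, `T`-periodic in `x`, with weak
gradient `(gradX, gradY)` and trace `U(·, 0) = trace` such that
`∫∫ y^a |∇U|² dx dy + ∫ U(x,0)² dx < ∞` over one period, where `a = 1 - 2 s`.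

The weak gradient and the trace are those given by Green's formula against test functions which
need not vanish on `y = 0`; they are determined almost everywhere by `U`. -/
structure HT (s T : ℝ) where
  toFun : ℝ × ℝ → ℝ
  gradX : ℝ × ℝ → ℝ
  gradY : ℝ × ℝ → ℝ
  trace : L2T T
  periodic : ∀ x y : ℝ, toFun (x + T, y) = toFun (x, y)
  gradX_periodic : ∀ x y : ℝ, gradX (x + T, y) = gradX (x, y)
  gradY_periodic : ∀ x y : ℝ, gradY (x + T, y) = gradY (x, y)
  integrableOn : ∀ R : ℝ, IntegrableOn toFun (period T ×ˢ Ioc (0 : ℝ) R)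
  gradX_meas : AEStronglyMeasurable gradX (volume.restrict (strip T))
  gradY_meas : AEStronglyMeasurable gradY (volume.restrict (strip T))
  finite_energy :
    IntegrableOn (fun p : ℝ × ℝ => p.2 ^ (1 - 2 * s) * (gradX p ^ 2 + gradY p ^ 2)) (strip T)
  green_x : ∀ φ : ℝ × ℝ → ℝ, IsTest T φ →
    ∫ p in strip T, toFun p * fderiv ℝ φ p (1, 0) = - ∫ p in strip T, gradX p * φ p
  green_y : ∀ φ : ℝ × ℝ → ℝ, IsTest T φ →
    ∫ p in strip T, toFun p * fderiv ℝ φ p (0, 1) =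
      - (∫ p in strip T, gradY p * φ p)
        - ∫ x in period T, (trace : ℝ →ₘ[(volume : Measure ℝ)] ℝ) x * φ (x, 0)

/-- The constant `d_s = 2^(2s-1) Γ(s) / Γ(1-s)`, for which
`(-∂_xx)^s u = - d_s lim_{y ↓ 0} y^(1-2s) ∂_y U` has Fourier symbol `|ξ|^(2s)`, where `U` is the
`s`-harmonic extension of `u`. -/
noncomputable def dConst (s : ℝ) : ℝ :=
  2 ^ (2 * s - 1) * Real.Gamma s / Real.Gamma (1 - s)

/-- The bilinear form of `L = (-∂_xx)^s + k` on `𝓗_T`: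
`B(U, V) = d_s ∫∫ y^(1-2s) ∇U · ∇V dx dy + ∫ k(x) U(x,0) V(x,0) dx`. -/
noncomputable def form {s T : ℝ} (k : ℝ → ℝ) (U V : HT s T) : ℝ :=
  dConst s * (∫ p in strip T,
      p.2 ^ (1 - 2 * s) * (U.gradX p * V.gradX p + U.gradY p * V.gradY p))
    + ∫ x in period T, k x * (U.trace : ℝ →ₘ[(volume : Measure ℝ)] ℝ) x *
        (V.trace : ℝ →ₘ[(volume : Measure ℝ)] ℝ) x

/-- `u` is a weak `T`-periodic solution of `(-∂_xx)^s u + k u = g`: it is the trace of some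
`U ∈ 𝓗_T` with `B(U, V) = ⟨g, V(·, 0)⟩` for all `V ∈ 𝓗_T`. -/
def IsWeakSolution (s T : ℝ) (k : ℝ → ℝ) (g u : L2T T) : Prop :=
  ∃ U : HT s T, U.trace = u ∧ ∀ V : HT s T, form k U V = pairing g V.trace

end PeriodicFracLap

/-! An extension `U` is recorded by the triple `u = (w ∂_x U, w ∂_y U, U(·, 0))` with `w² = d_s
y^(1-2s)`. In the `L²` inner product of triples, `B(U, V) = ⟪u, v⟫ + ⟪(k - 1) t u, t v⟫`, where `t`
is the trace; the `-1` pays for the trace term contained in `⟪u, v⟫`. The equation becomes `(1 + C)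
u = t* g` with `C = t* (k - 1) t` symmetric. Once `t` is compact, so is `C`, and `1 + C` has
finite-dimensional kernel and range equal to the orthogonal complement of that kernel
(`exists_fredholm_subspace`). The solutions of the homogeneous equation are the traces of the
kernel, and the dichotomy is whether they reduce to zero.

Completeness: the triples that arise are exactly those orthogonal to a family of test vectors
expressing that the field is curl-free and compatible with its trace (`HT.exists_represents`,
`exists_HT_represents`). An orthogonal complement is closed, hence a Hilbert space.

Compactness of `t` (`isCompactOperator_traceL`): for a cutoff `χ` in `y` supported below height `δ`,
put `P = ∫ χ ∂_y U dy` and `Q = ∫ χ' ∂_x U dy`. The curl condition tested with `f(x) χ(y)` says `(t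
u + P)' = -Q` on the circle. By Cauchy-Schwarz `P` is small for small `δ`, because `∫_0^δ w⁻²` is a
multiple of `δ^(2s)`. The `n`-th Fourier coefficient of `t u + P` is that of `Q` divided by a
multiple of `n`, hence small for large `n`. So `t` is small on functions whose trace has no low
frequencies, and is a norm limit of finite-rank operators. -/

namespace PeriodicFracLap

/-! ### Abstract Fredholm theory for compact symmetric perturbations of the identity. -/

section FunctionalAnalysis

variable {H L : Type*} [NormedAddCommGroup H] [InnerProductSpace ℝ H]
  [NormedAddCommGroup L] [InnerProductSpace ℝ L]

/-- The eigenspace of a compact operator for the eigenvalue `-1` is finite-dimensional. -/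
theorem finiteDimensional_ker_id_add {C : H →L[ℝ] H} (hC : IsCompactOperator C) :
    FiniteDimensional ℝ (LinearMap.ker (ContinuousLinearMap.id ℝ H + C).toLinearMap) := by
  set K := LinearMap.ker (ContinuousLinearMap.id ℝ H + C).toLinearMap
  have hmem : ∀ v : H, v ∈ K → C v = -v := by
    intro v hv
    have : v + C v = 0 := hv
    exact (neg_eq_of_add_eq_zero_right this).symm
  have hK : ∀ v ∈ K, C.toLinearMap v ∈ K := fun v hv => by
    rw [ContinuousLinearMap.coe_coe, hmem v hv]
    exact K.neg_mem hv
  have hcl : IsClosed (K : Set H) := (ContinuousLinearMap.id ℝ H + C).isClosed_ker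
  have h1 : IsCompactOperator (C.toLinearMap.restrict hK) :=
    IsCompactOperator.restrict (f := C.toLinearMap) hC hK hcl
  -- On the kernel the identity equals `-C`, so it is compact, and Riesz' theorem applies.
  refine FiniteDimensional.of_isCompactOperator_id (𝕜 := ℝ) ?_
  have h2 : (id : K → K) = -⇑(C.toLinearMap.restrict hK) := by
    funext v
    apply Subtype.ext
    simp [hmem v v.2]
  rw [h2]
  exact h1.neg

/-- The Fredholm alternative for a compact symmetric perturbation of the identity. -/
theorem exists_add_apply_eq_of_orthogonal [CompleteSpace H] {C : H →L[ℝ] H} (hC : IsCompactOperator C)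
    (hsymm : ∀ u v : H, inner ℝ (C u) v = inner ℝ u (C v)) {f : H}
    (hf : ∀ w : H, w + C w = 0 → inner ℝ f w = 0) : ∃ u : H, u + C u = f := by
  set K := LinearMap.ker (ContinuousLinearMap.id ℝ H + C).toLinearMap
  have hmem : ∀ v : H, v ∈ K ↔ v + C v = 0 := fun v => Iff.rfl
  -- Symmetry makes the complement of the kernel invariant, so `C` restricts to a compact operator
  -- `D` there.
  have hW : ∀ w ∈ Kᗮ, C.toLinearMap w ∈ Kᗮ := by
    intro w hw
    rw [Submodule.mem_orthogonal] at hw ⊢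
    intro v hv
    rw [ContinuousLinearMap.coe_coe, ← hsymm v w,
      (neg_eq_of_add_eq_zero_right ((hmem v).1 hv)).symm, inner_neg_left, hw v hv, neg_zero]
  let D : Kᗮ →L[ℝ] Kᗮ := ⟨C.toLinearMap.restrict hW,
    (C.continuous.comp continuous_subtype_val).subtype_mk _⟩
  have hD : IsCompactOperator D :=
    IsCompactOperator.restrict (f := C.toLinearMap) hC hW K.isClosed_orthogonal
  have hval : ∀ w : Kᗮ, (D w : H) = C w := fun _ => rfl
  -- An eigenvector of `D` for `-1` would lie in both `K` and `Kᗮ`, so `-1` is in the resolvent set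
  -- and `-1 - D` is onto. Hence the sign of `-f` below.
  rcases hD.hasEigenvalue_or_mem_resolventSet (μ := (-1 : ℝ)) (by norm_num) with h | h
  · obtain ⟨w, hw, hw0⟩ := h.exists_hasEigenvector
    refine absurd ?_ hw0
    have h1 : D w = (-1 : ℝ) • w := Module.End.mem_eigenspace_iff.1 hw
    have h2 : (w : H) ∈ K := by
      rw [hmem, ← hval, h1]
      simp
    apply Subtype.ext
    exact inner_self_eq_zero (𝕜 := ℝ).1 ((Submodule.mem_orthogonal K (w : H)).1 w.2 _ h2)
  · rw [spectrum.mem_resolventSet_iff, ContinuousLinearMap.isUnit_iff_bijective] at h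
    have hfW : f ∈ Kᗮ := by
      rw [Submodule.mem_orthogonal']
      exact fun v hv => hf v hv
    obtain ⟨u, hu⟩ := h.2 ⟨-f, Kᗮ.neg_mem hfW⟩
    refine ⟨u, ?_⟩
    have h3 := congrArg Subtype.val hu
    simp only [sub_apply, map_neg, map_one, neg_apply,
      one_apply_eq_self, Submodule.coe_sub, Submodule.coe_neg, hval] at h3
    rw [← neg_inj, ← h3]
    abel

/-- An operator that is arbitrarily small on the vectors with image orthogonal to a suitable finite set
is compact. -/
theorem isCompactOperator_of_small_on_orthogonal [CompleteSpace H] [CompleteSpace L]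
    (t : H →L[ℝ] L) (h : ∀ ε > 0, ∃ F : Set L, F.Finite ∧
      ∀ u : H, (∀ f ∈ F, inner ℝ f (t u) = 0) → ‖t u‖ ≤ ε * ‖u‖) : IsCompactOperator t := by
  have hcl := isClosed_setOfPred_isCompactOperator (σ₁₂ := RingHom.id ℝ) (M₁ := H) (M₂ := L)
  refine (hcl.closure_subset_iff.2 subset_rfl) (Metric.mem_closure_iff.2 fun ε hε => ?_)
  obtain ⟨F, hF, hu⟩ := h (ε / 2) (half_pos hε)
  -- Being orthogonal to `t* f` is the same as `t u` being orthogonal to `f`. Thus `t` is small on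
  -- `Sᗮ` and within `ε` of the finite-rank operator `t ∘ P_S`.
  let S := Submodule.span ℝ (t.adjoint '' F)
  have : FiniteDimensional ℝ S := FiniteDimensional.span_of_finite ℝ (hF.image _)
  refine ⟨t ∘L S.starProjection, ?_, ?_⟩
  · have : IsCompactOperator (t ∘L S.subtypeL) :=
      isCompactOperator_of_locallyCompactSpace_rng _
    exact this.comp_clm S.orthogonalProjectionOnto
  · rw [dist_eq_norm]
    refine lt_of_le_of_lt (ContinuousLinearMap.opNorm_le_bound _ (half_pos hε).le fun u => ?_)
      (half_lt_self hε)
    have h1 : u - S.starProjection u ∈ Sᗮ := Submodule.sub_starProjection_mem_orthogonal u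
    have h2 : ‖t (u - S.starProjection u)‖ ≤ ε / 2 * ‖u - S.starProjection u‖ :=
      hu _ fun f hf => by
        rw [← ContinuousLinearMap.adjoint_inner_left]
        exact (Submodule.mem_orthogonal S _).1 h1 _ (Submodule.subset_span ⟨f, hf, rfl⟩)
    have h3 : ‖u - S.starProjection u‖ ≤ ‖u‖ := by
      have := Sᗮ.norm_starProjection_apply_le u
      rwa [Submodule.starProjection_orthogonal_val] at this
    calc ‖(t - t ∘L S.starProjection) u‖ = ‖t (u - S.starProjection u)‖ := by simp
      _ ≤ ε / 2 * ‖u - S.starProjection u‖ := h2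
      _ ≤ ε / 2 * ‖u‖ := by gcongr

/-- The Fredholm alternative for the form `⟪w, v⟫ + ⟪M t w, t v⟫` with `t` compact and `M` symmetric:
the `t`-images of its kernel form a finite-dimensional space, and the functional `⟪g, t v⟫` is
represented by the form if and only if `g` is orthogonal to this space. -/
theorem exists_fredholm_subspace [CompleteSpace H] [CompleteSpace L] {t : H →L[ℝ] L}
    (ht : IsCompactOperator t) (M : L →L[ℝ] L)
    (hM : ∀ f g : L, inner ℝ (M f) g = inner ℝ f (M g)) :
    ∃ N : Submodule ℝ L, FiniteDimensional ℝ N ∧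
      (∀ f : L, f ∈ N ↔
        ∃ w : H, t w = f ∧ ∀ v : H, inner ℝ w v + inner ℝ (M (t w)) (t v) = 0) ∧
      ∀ g : L, (∃ w : H, ∀ v : H, inner ℝ w v + inner ℝ (M (t w)) (t v) = inner ℝ g (t v)) ↔
        ∀ f ∈ N, inner ℝ g f = 0 := by
  let C : H →L[ℝ] H := t.adjoint ∘L M ∘L t
  have hC : IsCompactOperator C := ht.clm_comp (t.adjoint ∘L M)
  have hinner : ∀ u v : H, inner ℝ (C u) v = inner ℝ (M (t u)) (t v) := fun u v =>
    ContinuousLinearMap.adjoint_inner_left t v (M (t u))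
  have hsymm : ∀ u v : H, inner ℝ (C u) v = inner ℝ u (C v) := fun u v => by
    rw [hinner, hM, real_inner_comm, ← hinner, real_inner_comm]
  have hker : ∀ w : H, w + C w = 0 ↔ ∀ v : H, inner ℝ w v + inner ℝ (M (t w)) (t v) = 0 := by
    intro w
    constructor
    · intro h v
      rw [← hinner, ← inner_add_left, h, inner_zero_left]
    · intro h
      refine ext_inner_right ℝ fun v => ?_
      rw [inner_add_left, hinner, h, inner_zero_left]
  have := finiteDimensional_ker_id_add hC
  refine ⟨(LinearMap.ker (ContinuousLinearMap.id ℝ H + C).toLinearMap).map t.toLinearMap,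
    inferInstance, fun f => ?_, fun g => ⟨?_, fun h => ?_⟩⟩
  · constructor
    · rintro ⟨w, hw, rfl⟩
      exact ⟨w, rfl, (hker w).1 hw⟩
    · rintro ⟨w, rfl, hw⟩
      exact ⟨w, (hker w).2 hw, rfl⟩
  · rintro ⟨w, hw⟩ _ ⟨z, hz, rfl⟩
    have hz' : z + C z = 0 := hz
    rw [ContinuousLinearMap.coe_coe, ← hw z, ← hinner, hsymm, ← inner_add_right, hz',
      inner_zero_right]
  · obtain ⟨w, hw⟩ := exists_add_apply_eq_of_orthogonal hC hsymm (f := t.adjoint g) fun z hz => by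
      rw [ContinuousLinearMap.adjoint_inner_left]
      exact h _ ⟨z, hz, rfl⟩
    refine ⟨w, fun v => ?_⟩
    rw [← hinner, ← inner_add_left, hw, ContinuousLinearMap.adjoint_inner_left]

end FunctionalAnalysis

/-! ### Periodic classes on the line and `L²` of one period. -/

/-- The representative in the period `(-T/2, T/2]` of a real number modulo `T`. -/
noncomputable def reduce {T : ℝ} (hT : 0 < T) (x : ℝ) : ℝ := toIocMod hT (-(T / 2)) x

theorem reduce_add {T : ℝ} (hT : 0 < T) (x : ℝ) : reduce hT (x + T) = reduce hT x := toIocMod_add_right hT _ x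

theorem period_eq (T : ℝ) : period T = Ioc (-(T / 2)) (-(T / 2) + T) := by
  rw [period]; congr 1; ring

theorem reduce_of_mem {T : ℝ} (hT : 0 < T) {x : ℝ} (hx : x ∈ period T) : reduce hT x = x := by
  rw [period_eq] at hx
  exact (toIocMod_eq_self hT).2 hx

theorem measurable_reduce {T : ℝ} (hT : 0 < T) : Measurable (reduce hT) := by
  have : Fact (0 < T) := ⟨hT⟩
  have h : reduce hT =
      fun x : ℝ => ((AddCircle.measurableEquivIoc T (-(T / 2)) (x : AddCircle T) : ℝ)) := by
    funext x
    rfl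
  rw [h]
  exact measurable_subtype_coe.comp
    ((AddCircle.measurableEquivIoc T (-(T / 2))).measurable.comp AddCircle.measurable_mk')

theorem measurableSet_period (T : ℝ) : MeasurableSet (period T) := measurableSet_Ioc

/-- Two almost everywhere periodic functions that agree on a period agree everywhere. -/
theorem ae_eq_of_ae_eq_period {T : ℝ} (hT : 0 < T) {f g : ℝ → ℝ} (hf : ∀ᵐ x : ℝ, f (x + T) = f x)
    (hg : ∀ᵐ x : ℝ, g (x + T) = g x) (h : f =ᵐ[volume.restrict (period T)] g) :
    f =ᵐ[volume] g := by
  have hshift : ∀ (n : ℤ) {p : ℝ → Prop}, (∀ᵐ x : ℝ, p x) → ∀ᵐ x : ℝ, p (x + n * T) :=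
    fun n p hp => (measurePreserving_add_right (volume : Measure ℝ)
      (n * T)).quasiMeasurePreserving.ae hp
  have hper : ∀ {f : ℝ → ℝ}, (∀ᵐ x : ℝ, f (x + T) = f x) →
      ∀ᵐ x : ℝ, ∀ n : ℤ, f (x + n * T) = f x := by
    intro f hf
    -- There are countably many translates, so one null set serves for all of them.
    filter_upwards [ae_all_iff.2 fun n : ℤ => hshift n hf] with x hx n
    have hstep : ∀ m : ℤ, f (x + (m + 1 : ℤ) * T) = f (x + m * T) := by
      intro m
      rw [← hx m]
      congr 1
      push_cast
      ring
    induction n using Int.induction_on with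
    | zero => simp
    | succ i ih => rw [hstep, ih]
    | pred i ih => rw [← ih, ← hstep (-(i : ℤ) - 1), sub_add_cancel]
  rw [Filter.EventuallyEq, ae_restrict_iff' (measurableSet_period T)] at h
  filter_upwards [hper hf, hper hg, ae_all_iff.2 fun n : ℤ => hshift n h] with x hfx hgx hx
  have h1 : reduce hT x = x + ((-toIocDiv hT (-(T / 2)) x : ℤ) : ℝ) * T := by
    have h2 : toIocMod hT (-(T / 2)) x = x - toIocDiv hT (-(T / 2)) x • T := rfl
    rw [reduce, h2, zsmul_eq_mul, Int.cast_neg]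
    ring
  rw [← hfx, ← hgx (-toIocDiv hT (-(T / 2)) x)]
  refine hx _ ?_
  rw [← h1, period_eq]
  exact toIocMod_mem_Ioc hT _ x

/-- The restriction of a class of `L²_T` to one period. -/
noncomputable def toL2 (T : ℝ) : L2T T →ₗ[ℝ] Lp ℝ 2 (volume.restrict (period T)) where
  toFun u := u.2.2.toLp
  map_add' u v := by
    rw [← MemLp.toLp_add]
    refine MemLp.toLp_congr _ _ (ae_restrict_of_ae ?_)
    exact AEEqFun.coeFn_add (u : ℝ →ₘ[(volume : Measure ℝ)] ℝ) v
  map_smul' c u := by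
    rw [RingHom.id_apply, ← MemLp.toLp_const_smul]
    refine MemLp.toLp_congr _ _ (ae_restrict_of_ae ?_)
    exact AEEqFun.coeFn_smul c (u : ℝ →ₘ[(volume : Measure ℝ)] ℝ)

theorem coeFn_toL2 {T : ℝ} (u : L2T T) :
    toL2 T u =ᵐ[volume.restrict (period T)] (u : ℝ →ₘ[(volume : Measure ℝ)] ℝ) :=
  MemLp.coeFn_toLp u.2.2

theorem pairing_eq_inner {T : ℝ} (u v : L2T T) : pairing u v = inner ℝ (toL2 T u) (toL2 T v) := by
  rw [L2.inner_def, pairing]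
  refine integral_congr_ae ?_
  filter_upwards [coeFn_toL2 u, coeFn_toL2 v] with x hu hv
  rw [hu, hv, real_inner_eq_re_inner]
  simp [mul_comm]

theorem toL2_injective {T : ℝ} (hT : 0 < T) : Function.Injective (toL2 T) := by
  intro u v huv
  apply Subtype.ext
  refine AEEqFun.ext (ae_eq_of_ae_eq_period hT u.2.1 v.2.1 ?_)
  have h := coeFn_toL2 u
  rw [huv] at h
  exact h.symm.trans (coeFn_toL2 v)

theorem toL2_surjective {T : ℝ} (hT : 0 < T) : Function.Surjective (toL2 T) := by
  intro f
  let F : ℝ → ℝ := fun x => f (reduce hT x)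
  have hF : StronglyMeasurable F :=
    (Lp.stronglyMeasurable f).comp_measurable (measurable_reduce hT)
  have hFf : F =ᵐ[volume.restrict (period T)] f := by
    rw [Filter.EventuallyEq, ae_restrict_iff' (measurableSet_period T)]
    exact .of_forall fun x hx => by simp only [F, reduce_of_mem hT hx]
  let G : ℝ →ₘ[(volume : Measure ℝ)] ℝ := AEEqFun.mk F hF.aestronglyMeasurable
  have hG : G =ᵐ[volume] F := AEEqFun.coeFn_mk _ _
  have hGF : G =ᵐ[volume.restrict (period T)] F := ae_restrict_of_ae hG
  have hGf := hGF.trans hFf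
  have hGm : G ∈ L2T T := by
    refine ⟨?_, ?_⟩
    · filter_upwards [hG, (measurePreserving_add_right (volume : Measure ℝ)
        T).quasiMeasurePreserving.ae hG] with x h1 h2
      rw [h1, h2]
      simp only [F, reduce_add]
    · exact (memLp_congr_ae hGf).2 (Lp.memLp f)
  exact ⟨⟨G, hGm⟩, Lp.ext ((coeFn_toL2 _).trans hGf)⟩

/-! ### The weight of the energy and its inverse. -/

theorem dConst_pos {s : ℝ} (hs0 : 0 < s) (hs1 : s < 1) : 0 < dConst s := by
  have h1 := Real.Gamma_pos_of_pos hs0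
  have h2 := Real.Gamma_pos_of_pos (sub_pos.2 hs1)
  rw [dConst]
  positivity

/-- The square root of the weight `d_s y^(1-2s)` of the energy. -/
noncomputable def weight (s y : ℝ) : ℝ := √(dConst s * y ^ (1 - 2 * s))

theorem weight_pos {s : ℝ} (hs0 : 0 < s) (hs1 : s < 1) {y : ℝ} (hy : 0 < y) : 0 < weight s y :=
  Real.sqrt_pos.2 (mul_pos (dConst_pos hs0 hs1) (Real.rpow_pos_of_pos hy _))

theorem weight_sq {s : ℝ} (hs0 : 0 < s) (hs1 : s < 1) {y : ℝ} (hy : 0 < y) :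
    weight s y ^ 2 = dConst s * y ^ (1 - 2 * s) :=
  Real.sq_sqrt (mul_pos (dConst_pos hs0 hs1) (Real.rpow_pos_of_pos hy _)).le

theorem measurable_weight (s : ℝ) : Measurable (weight s) :=
  ((measurable_id.pow_const _).const_mul _).sqrt

theorem measurableSet_strip (T : ℝ) : MeasurableSet (strip T) :=
  (measurableSet_period T).prod measurableSet_Ioi

theorem restrict_strip (T : ℝ) : (volume : Measure (ℝ × ℝ)).restrict (strip T) =
    (volume.restrict (period T)).prod (volume.restrict (Ioi (0 : ℝ))) := by
  rw [Measure.prod_restrict]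
  rfl

instance isFiniteMeasure_period (T : ℝ) :
    IsFiniteMeasure ((volume : Measure ℝ).restrict (period T)) :=
  inferInstanceAs (IsFiniteMeasure ((volume : Measure ℝ).restrict (Ioc (-(T / 2)) (T / 2))))

theorem inv_weight_sq {s : ℝ} (hs0 : 0 < s) (hs1 : s < 1) {y : ℝ} (hy : 0 < y) :
    (1 / weight s y) ^ 2 = (dConst s)⁻¹ * y ^ (2 * s - 1) := by
  rw [div_pow, weight_sq hs0 hs1 hy, one_pow, one_div, mul_inv, ← Real.rpow_neg hy.le]
  congr 2
  ring

/-- The exponent `2s - 1` exceeds `-1` because `s > 0`. This is what makes fields of finite energy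
integrable up to `y = 0`, and `ψ / w` square integrable for test functions that do not vanish there.
-/
theorem integrableOn_inv_weight_sq {s : ℝ} (hs0 : 0 < s) (hs1 : s < 1) (R : ℝ) :
    IntegrableOn (fun y => (1 / weight s y) ^ 2) (Ioc 0 R) := by
  have h : IntegrableOn (fun y : ℝ => (dConst s)⁻¹ * y ^ (2 * s - 1)) (Ioc 0 R) := by
    rcases le_or_gt R 0 with hR | hR
    · rw [Ioc_eq_empty (not_lt.2 hR)]
      exact integrableOn_empty
    · rw [← intervalIntegrable_iff_integrableOn_Ioc_of_le hR.le]
      exact (intervalIntegral.intervalIntegrable_rpow' (by linarith)).const_mul _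
  exact h.congr_fun (fun y hy => (inv_weight_sq hs0 hs1 hy.1).symm) measurableSet_Ioc

theorem setIntegral_inv_weight_sq {s : ℝ} (hs0 : 0 < s) (hs1 : s < 1) {R : ℝ} (hR : 0 ≤ R) :
    ∫ y in Ioc 0 R, (1 / weight s y) ^ 2 = (dConst s)⁻¹ * (R ^ (2 * s) / (2 * s)) := by
  rw [setIntegral_congr_fun measurableSet_Ioc fun y hy => inv_weight_sq hs0 hs1 hy.1,
    integral_const_mul, ← intervalIntegral.integral_of_le hR, integral_rpow (by left; linarith)]
  rw [sub_add_cancel, Real.zero_rpow (by positivity), sub_zero]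

/-! ### Test functions: bounds, derivatives and primitives. -/

/-- A continuous function is bounded on the part of the strip below any given height. -/
theorem exists_bound_of_vanishes {T : ℝ} {ψ : ℝ × ℝ → ℝ} (hc : Continuous ψ)
    (hv : ∃ R : ℝ, ∀ x y : ℝ, R ≤ y → ψ (x, y) = 0) :
    ∃ C R : ℝ, 0 ≤ C ∧ 0 < R ∧ (∀ x y, R ≤ y → ψ (x, y) = 0) ∧
      ∀ x ∈ period T, ∀ y, 0 ≤ y → |ψ (x, y)| ≤ C := by
  obtain ⟨R, hR⟩ := hv
  obtain ⟨C, hC⟩ := ((isCompact_Icc (a := -(T / 2)) (b := T / 2)).prod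
    (isCompact_Icc (a := 0) (b := R))).exists_bound_of_continuousOn hc.continuousOn
  refine ⟨max C 0, max R 1, le_max_right _ _, by positivity,
    fun x y h => hR x y ((le_max_left _ _).trans h), fun x hx y hy => ?_⟩
  rcases le_total R y with h | h
  · simp [hR x y h]
  · exact (hC (x, y) ⟨⟨hx.1.le, hx.2⟩, ⟨hy, h⟩⟩).trans (le_max_left _ _)

theorem memLp_div_weight {s T : ℝ} (hs0 : 0 < s) (hs1 : s < 1) {ψ : ℝ × ℝ → ℝ} (hc : Continuous ψ)
    (hv : ∃ R : ℝ, ∀ x y : ℝ, R ≤ y → ψ (x, y) = 0) :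
    MemLp (fun p : ℝ × ℝ => ψ p / weight s p.2) 2 (volume.restrict (strip T)) := by
  obtain ⟨C, R, hC0, hR0, hR, hC⟩ := exists_bound_of_vanishes (T := T) hc hv
  have hm : Measurable (fun p : ℝ × ℝ => ψ p / weight s p.2) :=
    hc.measurable.div ((measurable_weight s).comp measurable_snd)
  rw [memLp_two_iff_integrable_sq hm.aestronglyMeasurable]
  have h1 : Integrable (fun y => (Ioc 0 R).indicator (fun y => (1 / weight s y) ^ 2) y)
      (volume.restrict (Ioi (0 : ℝ))) :=
    ((integrableOn_inv_weight_sq hs0 hs1 R).integrable_indicator measurableSet_Ioc).restrict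
  have h2 := Integrable.mul_prod (integrable_const (C ^ 2) (μ := volume.restrict (period T))) h1
  rw [← restrict_strip] at h2
  refine h2.mono' (hm.pow_const 2).aestronglyMeasurable ?_
  filter_upwards [ae_restrict_mem (measurableSet_strip T)] with p hp
  obtain ⟨x, y⟩ := p
  have hy : 0 < y := hp.2
  rcases le_or_gt R y with h | h
  · rw [hR x y h]
    simp only [zero_div]
    rw [zero_pow two_ne_zero, norm_zero]
    exact mul_nonneg (sq_nonneg _) (indicator_nonneg (fun _ _ => sq_nonneg _) _)
  · rw [indicator_of_mem (show y ∈ Ioc 0 R from ⟨hy, h.le⟩), Real.norm_of_nonneg (sq_nonneg _),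
      div_pow, one_div, inv_pow, ← div_eq_mul_inv]
    exact mul_le_mul_of_nonneg_right
      (sq_le_sq' (abs_le.1 (hC x hp.1 y hy.le)).1 (abs_le.1 (hC x hp.1 y hy.le)).2)
      (inv_nonneg.2 (sq_nonneg _))

theorem memLp_slice {T : ℝ} {ψ : ℝ → ℝ} (hc : Continuous ψ) :
    MemLp ψ 2 (volume.restrict (period T)) := by
  obtain ⟨C, hC⟩ := (isCompact_Icc (a := -(T / 2)) (b := T / 2)).exists_bound_of_continuousOn
    hc.continuousOn
  refine MemLp.of_bound hc.aestronglyMeasurable C ?_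
  filter_upwards [ae_restrict_mem (measurableSet_period T)] with x hx
  exact hC x ⟨hx.1.le, hx.2⟩

theorem IsTest.contDiff_fderiv_apply {T : ℝ} {φ : ℝ × ℝ → ℝ} (h : IsTest T φ) (v : ℝ × ℝ) :
    ContDiff ℝ ∞ (fun p => fderiv ℝ φ p v) :=
  (h.smooth.fderiv_right (m := ∞) (by simp)).clm_apply contDiff_const

/-- Directional derivatives of test functions are test functions. -/
theorem IsTest.fderiv_apply {T : ℝ} {φ : ℝ × ℝ → ℝ} (h : IsTest T φ) (v : ℝ × ℝ) :
    IsTest T (fun p => fderiv ℝ φ p v) where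
  smooth := h.contDiff_fderiv_apply v
  periodic x y := by
    have h1 : (fun p : ℝ × ℝ => φ (p + (T, 0))) = φ := by
      funext p
      rw [← h.periodic p.1 p.2]
      congr 1
      ext <;> simp
    have h2 := fderiv_comp_add_right (𝕜 := ℝ) (f := φ) (x := (x, y)) (T, 0)
    rw [h1] at h2
    rw [h2]
    simp
  vanishes := by
    obtain ⟨R, hR⟩ := h.vanishes
    -- The margin `1` makes `φ` vanish on a whole neighbourhood of the point.
    refine ⟨R + 1, fun x y hy => ?_⟩
    have h1 : φ =ᶠ[nhds (x, y)] fun _ => 0 := by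
      have h2 : {p : ℝ × ℝ | R < p.2} ∈ nhds (x, y) :=
        (isOpen_lt continuous_const continuous_snd).mem_nhds (by simp; linarith)
      filter_upwards [h2] with p hp
      exact hR p.1 p.2 (le_of_lt hp)
    rw [h1.fderiv_eq]
    simp

theorem IsTest.fderiv_comm {T : ℝ} {φ : ℝ × ℝ → ℝ} (h : IsTest T φ) (p v w : ℝ × ℝ) :
    fderiv ℝ (fun q => fderiv ℝ φ q v) p w = fderiv ℝ (fun q => fderiv ℝ φ q w) p v := by
  have hd : DifferentiableAt ℝ (fderiv ℝ φ) p :=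
    ((h.smooth.fderiv_right (m := ∞) (by simp)).differentiable (by simp)).differentiableAt
  have hs : IsSymmSndFDerivAt ℝ φ p := (h.smooth.contDiffAt).isSymmSndFDerivAt
    (by simpa using WithTop.coe_le_coe.2 (le_top (a := (2 : ℕ∞))))
  have hv : ∀ u : ℝ × ℝ, fderiv ℝ (fun q => fderiv ℝ φ q u) p =
      (fderiv ℝ (fderiv ℝ φ) p).flip u := by
    intro u
    rw [fderiv_clm_apply hd (differentiableAt_const u)]
    simp
  rw [hv, hv]
  exact hs.eq w v

/-- Every test function is, on the half-plane `y > 0`, the `y`-derivative of a test function. -/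
theorem IsTest.exists_primitive {T : ℝ} {φ : ℝ × ℝ → ℝ} (h : IsTest T φ) :
    ∃ η : ℝ × ℝ → ℝ, IsTest T η ∧ ∀ x y : ℝ, 0 < y → fderiv ℝ η (x, y) (0, 1) = φ (x, y) := by
  obtain ⟨R, hR⟩ := h.vanishes
  -- The factor is `1` for `y ≥ 0` and `0` for `y ≤ -1`: it leaves the half-plane untouched and
  -- gives every slice in `y` a support in the same compact interval.
  let g : ℝ → ℝ → ℝ := fun x y => φ (x, y) * Real.smoothTransition (y + 1)
  have hg : ContDiff ℝ ∞ (fun p : ℝ × ℝ => g p.1 p.2) :=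
    h.smooth.mul (Real.smoothTransition.contDiff.comp (contDiff_snd.add contDiff_const))
  have hgx : ∀ x, Continuous (g x) := fun x =>
    hg.continuous.comp (continuous_const.prodMk continuous_id)
  have hg0 : ∀ x y, y ∉ Icc (-1) R → g x y = 0 := by
    intro x y hy
    rw [mem_Icc, not_and_or, not_le, not_le] at hy
    rcases hy with hy | hy
    · simp [g, Real.smoothTransition.zero_of_nonpos (show y + 1 ≤ 0 by linarith)]
    · simp [g, hR x y hy.le]
  have hgi : ∀ x, Integrable (g x) := fun x =>
    (hgx x).integrable_of_hasCompactSupport (HasCompactSupport.intro isCompact_Icc (hg0 x))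
  -- Convolution with `-1` on `(-∞, 0]` gives the primitive `-∫_y^∞ g`, the one that vanishes for
  -- large `y`. Smoothness in both variables then comes from convolution with a parameter.
  let f : ℝ → ℝ := (Iic (0 : ℝ)).indicator fun _ => -1
  let η : ℝ × ℝ → ℝ := fun q =>
    convolution f (g q.1) (ContinuousLinearMap.mul ℝ ℝ) volume q.2
  have hη : ContDiff ℝ ∞ η := by
    rw [← contDiffOn_univ, ← univ_prod_univ]
    refine contDiffOn_convolution_right_with_param (n := ⊤) (ContinuousLinearMap.mul ℝ ℝ)
      isOpen_univ (isCompact_Icc (a := -1) (b := R)) (fun p x _ => hg0 p x) ?_ hg.contDiffOn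
    exact (locallyIntegrable_const (-1 : ℝ)).indicator measurableSet_Iic
  have hηI : ∀ x y, η (x, y) = -∫ u in Ioi y, g x u := by
    intro x y
    have h1 : η (x, y) = ∫ t, f t * g x (y - t) := rfl
    rw [h1, ← integral_sub_left_eq_self _ volume y, ← integral_Ici_eq_integral_Ioi,
      ← integral_indicator measurableSet_Ici, ← integral_neg]
    refine integral_congr_ae (.of_forall fun u => ?_)
    by_cases hu : y ≤ u
    · simp [f, indicator, hu]
    · simp [f, indicator, hu]
  refine ⟨η, ⟨hη, fun x y => ?_, R, fun x y hy => ?_⟩, fun x y hy => ?_⟩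
  · rw [hηI, hηI]
    simp only [g, h.periodic]
  · rw [hηI, setIntegral_eq_zero_of_forall_eq_zero, neg_zero]
    intro u hu
    simp only [g, hR x u (hy.trans (le_of_lt hu)), zero_mul]
  · have h1 : HasDerivAt (fun t => η (x, t)) (g x y) y := by
      have h2 : (fun t => η (x, t)) = fun t => (∫ u in (0 : ℝ)..t, g x u) - ∫ u in Ioi 0, g x u := by
        funext t
        rw [hηI, ← intervalIntegral.integral_interval_add_Ioi (a := 0) (b := t)
          (hgi x).integrableOn (hgi x).integrableOn]
        ring
      rw [h2]
      exact (intervalIntegral.integral_hasDerivAt_right ((hgx x).intervalIntegrable _ _)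
        ((hgx x).stronglyMeasurableAtFilter _ _) (hgx x).continuousAt).sub_const _
    have h3 : HasDerivAt (fun t => η (x, t)) (fderiv ℝ η (x, y) (0, 1)) y :=
      ((hη.differentiable (by simp)).differentiableAt.hasFDerivAt (x := (x, y))).comp_hasDerivAt y
        ((hasDerivAt_const y x).prodMk (hasDerivAt_id y))
    rw [h3.unique h1]
    simp [g, Real.smoothTransition.one_of_one_le (show 1 ≤ y + 1 by linarith)]

/-! ### Primitives in `y` and Green's formula in `y`. -/

/-- Integration by parts on `(0, R]` of a primitive against a smooth function vanishing at `R`. -/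
theorem setIntegral_primitive_mul_deriv {R b : ℝ} (hR : 0 ≤ R) {g φ φ' : ℝ → ℝ}
    (hg : IntegrableOn g (Ioc 0 R)) (hφ : ∀ y, HasDerivAt φ (φ' y) y) (hφ' : Continuous φ')
    (hφR : φ R = 0) :
    ∫ y in Ioc 0 R, (b + ∫ t in Ioc 0 y, g t) * φ' y =
      -(∫ y in Ioc 0 R, g y * φ y) - b * φ 0 := by
  have hφ'i : ∀ a c : ℝ, IntervalIntegrable φ' volume a c := fun a c => hφ'.intervalIntegrable a c
  have hφ'on : IntegrableOn φ' (Ioc 0 R) :=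
    (intervalIntegrable_iff_integrableOn_Ioc_of_le hR).1 (hφ'i 0 R)
  -- The kernel of the double integral over the triangle `t ≤ y`. Fubini replaces differentiation of
  -- the primitive, whose integrand is only integrable.
  let K : ℝ → ℝ → ℝ := fun y t => {q : ℝ × ℝ | q.2 ≤ q.1}.indicator (fun q => φ' q.1 * g q.2) (y, t)
  have hK : Integrable (Function.uncurry K)
      ((volume.restrict (Ioc 0 R)).prod (volume.restrict (Ioc 0 R))) :=
    (Integrable.mul_prod hφ'on hg).indicator (measurableSet_le measurable_snd measurable_fst)
  have h1 : ∀ y ∈ Ioc 0 R, φ' y * ∫ t in Ioc 0 y, g t = ∫ t in Ioc 0 R, K y t := by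
    intro y hy
    have h2 : ∀ t, K y t = (Iic y).indicator (fun t => φ' y * g t) t := by
      intro t
      by_cases h : t ≤ y <;> simp [K, indicator, h]
    simp only [h2]
    rw [setIntegral_indicator measurableSet_Iic, Ioc_inter_Iic, min_eq_right hy.2,
      integral_const_mul]
  have h3 : ∀ t ∈ Ioc 0 R, ∫ y in Ioc 0 R, K y t = -(g t * φ t) := by
    intro t ht
    have h2 : ∀ y, K y t = (Ici t).indicator (fun y => φ' y * g t) y := by
      intro y
      by_cases h : t ≤ y <;> simp [K, indicator, h]
    simp only [h2]
    have h4 : Ioc 0 R ∩ Ici t = Icc t R := by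
      ext y
      simp only [mem_inter_iff, mem_Ioc, mem_Ici, mem_Icc]
      exact ⟨fun h => ⟨h.2, h.1.2⟩, fun h => ⟨⟨ht.1.trans_le h.1, h.2⟩, h.1⟩⟩
    rw [setIntegral_indicator measurableSet_Ici, h4, integral_Icc_eq_integral_Ioc,
      integral_mul_const, ← intervalIntegral.integral_of_le ht.2,
      intervalIntegral.integral_eq_sub_of_hasDerivAt (fun y _ => hφ y) (hφ'i _ _), hφR]
    ring
  have h5 : ∫ y in Ioc 0 R, φ' y * ∫ t in Ioc 0 y, g t = -∫ t in Ioc 0 R, g t * φ t := by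
    rw [setIntegral_congr_fun measurableSet_Ioc h1, integral_integral_swap hK,
      setIntegral_congr_fun measurableSet_Ioc h3, integral_neg]
  have h6 : IntegrableOn (fun y => φ' y * ∫ t in Ioc 0 y, g t) (Ioc 0 R) :=
    (integrableOn_congr_fun h1 measurableSet_Ioc).2 hK.integral_prod_left
  have h7 : ∫ y in Ioc 0 R, φ' y = -φ 0 := by
    rw [← intervalIntegral.integral_of_le hR,
      intervalIntegral.integral_eq_sub_of_hasDerivAt (fun y _ => hφ y) (hφ'i _ _), hφR, zero_sub]
  calc ∫ y in Ioc 0 R, (b + ∫ t in Ioc 0 y, g t) * φ' y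
      = ∫ y in Ioc 0 R, (b * φ' y + φ' y * ∫ t in Ioc 0 y, g t) := by
        congr 1; funext y; ring
    _ = b * (-φ 0) + -∫ t in Ioc 0 R, g t * φ t := by
        rw [integral_add (hφ'on.const_mul b) h6, integral_const_mul, h7, h5]
    _ = _ := by ring

theorem restrict_box (T R : ℝ) : (volume : Measure (ℝ × ℝ)).restrict (period T ×ˢ Ioc 0 R) =
    (volume.restrict (period T)).prod (volume.restrict (Ioc (0 : ℝ) R)) := by
  rw [Measure.prod_restrict]
  rfl

theorem measurableSet_box (T R : ℝ) : MeasurableSet (period T ×ˢ Ioc (0 : ℝ) R) :=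
  (measurableSet_period T).prod measurableSet_Ioc

theorem box_subset_strip (T R : ℝ) : period T ×ˢ Ioc 0 R ⊆ strip T :=
  prod_mono_right Ioc_subset_Ioi_self

theorem stronglyMeasurable_primitive {b : ℝ → ℝ} (hb : StronglyMeasurable b) {g : ℝ × ℝ → ℝ}
    (hg : StronglyMeasurable g) :
    StronglyMeasurable (fun p : ℝ × ℝ => b p.1 + ∫ t in Ioc 0 p.2, g (p.1, t)) := by
  refine (hb.comp_measurable measurable_fst).add ?_
  let F : (ℝ × ℝ) × ℝ → ℝ :=
    {q : (ℝ × ℝ) × ℝ | 0 < q.2 ∧ q.2 ≤ q.1.2}.indicator fun q => g (q.1.1, q.2)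
  have hF : StronglyMeasurable F := by
    refine StronglyMeasurable.indicator (hg.comp_measurable (by fun_prop)) ?_
    exact (measurableSet_lt measurable_const measurable_snd).inter
      (measurableSet_le measurable_snd (measurable_snd.comp measurable_fst))
  have h1 : (fun p : ℝ × ℝ => ∫ t in Ioc 0 p.2, g (p.1, t)) = fun p => ∫ t, F (p, t) := by
    funext p
    rw [← integral_indicator measurableSet_Ioc]
    rfl
  rw [h1]
  exact hF.integral_prod_right'

/-- The primitive is dominated by `|b(x)| + ∫_0^R |g(x, t)| dt`, which does not depend on `y` and is
integrable in `x`. -/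
theorem integrableOn_primitive {T : ℝ} {b : ℝ → ℝ} (hb : StronglyMeasurable b)
    (hbi : IntegrableOn b (period T)) {g : ℝ × ℝ → ℝ} (hg : StronglyMeasurable g)
    (hgi : ∀ R, IntegrableOn g (period T ×ˢ Ioc 0 R)) (R : ℝ) :
    IntegrableOn (fun p : ℝ × ℝ => b p.1 + ∫ t in Ioc 0 p.2, g (p.1, t))
      (period T ×ˢ Ioc 0 R) := by
  have h0 := hgi R
  rw [IntegrableOn, restrict_box] at h0 ⊢
  have h1 : Integrable (fun x => |b x| + ∫ t in Ioc 0 R, ‖g (x, t)‖) (volume.restrict (period T)) :=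
    hbi.abs.add h0.integral_norm_prod_left
  refine (Integrable.mul_prod h1 (integrable_const (1 : ℝ))).mono'
    (stronglyMeasurable_primitive hb hg).aestronglyMeasurable ?_
  rw [← restrict_box]
  have h3 : ∀ᵐ p ∂(volume.restrict (period T ×ˢ Ioc 0 R)),
      IntegrableOn (fun t => g (p.1, t)) (Ioc 0 R) := by
    rw [restrict_box]
    exact Measure.quasiMeasurePreserving_fst.ae h0.prod_right_ae
  filter_upwards [h3, ae_restrict_mem (measurableSet_box T R)] with p hp hp2
  rw [mul_one]
  refine (norm_add_le _ _).trans (add_le_add le_rfl ((norm_integral_le_integral_norm _).trans ?_))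
  exact setIntegral_mono_set hp.norm (.of_forall fun t => norm_nonneg _)
    (Ioc_subset_Ioc_right hp2.2.2).eventuallyLE

theorem IsTest.continuous {T : ℝ} {φ : ℝ × ℝ → ℝ} (h : IsTest T φ) : Continuous φ :=
  h.smooth.continuous

theorem integrableOn_mul_of_bound {T R C : ℝ} {U ψ : ℝ × ℝ → ℝ}
    (hU : IntegrableOn U (period T ×ˢ Ioc 0 R)) (hψ : Continuous ψ)
    (hC : ∀ x ∈ period T, ∀ y, 0 ≤ y → |ψ (x, y)| ≤ C) :
    IntegrableOn (fun p => U p * ψ p) (period T ×ˢ Ioc 0 R) := by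
  refine Integrable.mul_bdd (c := C) hU hψ.aestronglyMeasurable ?_
  filter_upwards [ae_restrict_mem (measurableSet_box T R)] with p hp
  exact hC p.1 hp.1 p.2 hp.2.1.le

theorem setIntegral_strip_eq_box {T R : ℝ} {U ψ : ℝ × ℝ → ℝ}
    (hR : ∀ x y, R ≤ y → ψ (x, y) = 0) :
    ∫ p in strip T, U p * ψ p = ∫ p in period T ×ˢ Ioc 0 R, U p * ψ p := by
  refine setIntegral_eq_of_subset_of_forall_sdiff_eq_zero (measurableSet_strip T)
    (box_subset_strip T R) fun p hp => ?_
  have h1 : R < p.2 := by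
    by_contra h
    exact hp.2 ⟨hp.1.1, hp.1.2, not_lt.1 h⟩
  rw [hR p.1 p.2 h1.le, mul_zero]

/-- Green's formula in `y` for a function given as a primitive in `y`. -/
theorem green_primitive {T : ℝ} {b : ℝ → ℝ} (hb : StronglyMeasurable b)
    (hbi : IntegrableOn b (period T)) {g : ℝ × ℝ → ℝ} (hg : StronglyMeasurable g)
    (hgi : ∀ R, IntegrableOn g (period T ×ˢ Ioc 0 R)) {φ : ℝ × ℝ → ℝ} (hφ : IsTest T φ) :
    ∫ p in strip T, (b p.1 + ∫ t in Ioc 0 p.2, g (p.1, t)) * fderiv ℝ φ p (0, 1) =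
      -(∫ p in strip T, g p * φ p) - ∫ x in period T, b x * φ (x, 0) := by
  have hφ' := hφ.fderiv_apply (0, 1)
  obtain ⟨C₁, R₁, -, hR₁, hv₁, hC₁⟩ :=
    exists_bound_of_vanishes (T := T) hφ.continuous hφ.vanishes
  obtain ⟨C₂, R₂, -, hR₂, hv₂, hC₂⟩ :=
    exists_bound_of_vanishes (T := T) hφ'.continuous hφ'.vanishes
  set R := max R₁ R₂
  have hR0 : 0 < R := hR₁.trans_le (le_max_left _ _)
  have hi1 := integrableOn_mul_of_bound (integrableOn_primitive hb hbi hg hgi R) hφ'.continuous hC₂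
  have hi2 := integrableOn_mul_of_bound (hgi R) hφ.continuous hC₁
  rw [setIntegral_strip_eq_box (R := R)
      fun x y h => hv₂ x y ((le_max_right _ _).trans h),
    setIntegral_strip_eq_box (R := R) fun x y h => hv₁ x y ((le_max_left _ _).trans h)]
  have hg2 := hgi R
  rw [IntegrableOn, restrict_box] at hi1 hi2 hg2
  rw [restrict_box, integral_prod _ hi1, integral_prod _ hi2]
  have hb2 : IntegrableOn (fun x => b x * φ (x, 0)) (period T) := by
    refine Integrable.mul_bdd (c := C₁) hbi
      (hφ.continuous.comp (continuous_id.prodMk continuous_const)).aestronglyMeasurable ?_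
    filter_upwards [ae_restrict_mem (measurableSet_period T)] with x hx
    exact hC₁ x hx 0 le_rfl
  have hi3 : Integrable (fun x => -∫ y in Ioc 0 R, g (x, y) * φ (x, y))
      (volume.restrict (period T)) := hi2.integral_prod_left.neg
  rw [← integral_neg, ← integral_sub hi3 hb2]
  refine integral_congr_ae ?_
  filter_upwards [hg2.prod_right_ae] with x hx
  refine setIntegral_primitive_mul_deriv hR0.le hx (fun y => ?_)
    (hφ'.continuous.comp (continuous_const.prodMk continuous_id))
    (hv₁ x R (le_max_left _ _))
  exact ((hφ.smooth.differentiable (by simp)).differentiableAt.hasFDerivAt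
    (x := (x, y))).comp_hasDerivAt y ((hasDerivAt_const y x).prodMk (hasDerivAt_id y))

/-! ### The energy space: triples that satisfy the curl condition. -/

/-- Pairs of square integrable fields on the strip together with a square integrable trace. -/
abbrev Ambient (T : ℝ) : Type :=
  WithLp 2 (Lp ℝ 2 ((volume : Measure (ℝ × ℝ)).restrict (strip T)) ×
    WithLp 2 (Lp ℝ 2 ((volume : Measure (ℝ × ℝ)).restrict (strip T)) ×
      Lp ℝ 2 ((volume : Measure ℝ).restrict (period T))))

/-- The vectors orthogonality to which says that a field is the gradient of a function with the
given trace: `v` represents `(∂_y η, -∂_x η, -∂_x η(·, 0))` for a test function `η`. -/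
def curlVectors (s T : ℝ) : Set (Ambient T) :=
  {v | ∃ η : ℝ × ℝ → ℝ, IsTest T η ∧
    (v.fst =ᵐ[volume.restrict (strip T)] fun p => fderiv ℝ η p (0, 1) / weight s p.2) ∧
    (v.snd.fst =ᵐ[volume.restrict (strip T)] fun p => -(fderiv ℝ η p (1, 0) / weight s p.2)) ∧
    (v.snd.snd =ᵐ[volume.restrict (period T)] fun x => -fderiv ℝ η (x, 0) (1, 0))}

/-- The Hilbert space of triples `(w ∂_x U, w ∂_y U, U(·, 0))`, `w = √(d_s y^(1-2s))`. -/
noncomputable def energySpace (s T : ℝ) : Submodule ℝ (Ambient T) := (Submodule.span ℝ (curlVectors s T))ᗮ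

instance completeSpace_energySpace (s T : ℝ) : CompleteSpace (energySpace s T) :=
  inferInstanceAs (CompleteSpace (Submodule.span ℝ (curlVectors s T))ᗮ)

theorem inner_Lp {α : Type*} [MeasurableSpace α] {μ : Measure α} (f g : Lp ℝ 2 μ) :
    inner ℝ f g = ∫ x, f x * g x ∂μ := by
  rw [L2.inner_def]
  refine integral_congr_ae (.of_forall fun x => ?_)
  simp [mul_comm]

theorem integrable_mul_Lp {α : Type*} [MeasurableSpace α] {μ : Measure α} (f g : Lp ℝ 2 μ) :
    Integrable (fun x => f x * g x) μ :=
  (Lp.memLp f).integrable_mul (Lp.memLp g)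

theorem inner_ambient {T : ℝ} (u v : Ambient T) : inner ℝ u v =
    inner ℝ u.fst v.fst + (inner ℝ u.snd.fst v.snd.fst + inner ℝ u.snd.snd v.snd.snd) := rfl

theorem inner_curlVector {s T : ℝ} (u : Ambient T) {v : Ambient T} {η : ℝ × ℝ → ℝ}
    (h1 : v.fst =ᵐ[volume.restrict (strip T)] fun p => fderiv ℝ η p (0, 1) / weight s p.2)
    (h2 : v.snd.fst =ᵐ[volume.restrict (strip T)] fun p => -(fderiv ℝ η p (1, 0) / weight s p.2))
    (h3 : v.snd.snd =ᵐ[volume.restrict (period T)] fun x => -fderiv ℝ η (x, 0) (1, 0)) :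
    inner ℝ u v = (∫ p in strip T, u.fst p * (fderiv ℝ η p (0, 1) / weight s p.2))
      - (∫ p in strip T, u.snd.fst p * (fderiv ℝ η p (1, 0) / weight s p.2))
      - ∫ x in period T, u.snd.snd x * fderiv ℝ η (x, 0) (1, 0) := by
  rw [inner_ambient, inner_Lp, inner_Lp, inner_Lp, sub_sub, sub_eq_add_neg, neg_add,
    ← integral_neg, ← integral_neg]
  congr 1
  · refine integral_congr_ae ?_
    filter_upwards [h1] with p hp
    rw [hp]
  congr 1
  · refine integral_congr_ae ?_
    filter_upwards [h2] with p hp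
    rw [hp, mul_neg]
  · refine integral_congr_ae ?_
    filter_upwards [h3] with p hp
    rw [hp, mul_neg]

/-- Shows that every test function contributes a vector to `curlVectors`, so that orthogonality to
this set really imposes the condition for all test functions. -/
theorem IsTest.exists_curlVector {s T : ℝ} (hs0 : 0 < s) (hs1 : s < 1) {η : ℝ × ℝ → ℝ}
    (hη : IsTest T η) : ∃ v : Ambient T,
      (v.fst =ᵐ[volume.restrict (strip T)] fun p => fderiv ℝ η p (0, 1) / weight s p.2) ∧
      (v.snd.fst =ᵐ[volume.restrict (strip T)] fun p => -(fderiv ℝ η p (1, 0) / weight s p.2)) ∧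
      (v.snd.snd =ᵐ[volume.restrict (period T)] fun x => -fderiv ℝ η (x, 0) (1, 0)) := by
  have hy := hη.fderiv_apply (0, 1)
  have hx := hη.fderiv_apply (1, 0)
  have m1 := memLp_div_weight (T := T) hs0 hs1 hy.continuous hy.vanishes
  have m2 := (memLp_div_weight (T := T) hs0 hs1 hx.continuous hx.vanishes).neg
  have m3 := (memLp_slice (T := T)
    (hx.continuous.comp (continuous_id.prodMk (continuous_const (y := (0 : ℝ)))))).neg
  exact ⟨WithLp.toLp 2 (m1.toLp, WithLp.toLp 2 (m2.toLp, m3.toLp)),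
    m1.coeFn_toLp, m2.coeFn_toLp, m3.coeFn_toLp⟩

theorem mem_energySpace_iff {s T : ℝ} (hs0 : 0 < s) (hs1 : s < 1) (u : Ambient T) :
    u ∈ energySpace s T ↔ ∀ η : ℝ × ℝ → ℝ, IsTest T η →
      (∫ p in strip T, u.fst p * (fderiv ℝ η p (0, 1) / weight s p.2))
      - (∫ p in strip T, u.snd.fst p * (fderiv ℝ η p (1, 0) / weight s p.2))
      - ∫ x in period T, u.snd.snd x * fderiv ℝ η (x, 0) (1, 0) = 0 := by
  rw [energySpace, Submodule.mem_orthogonal']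
  constructor
  · intro h η hη
    obtain ⟨v, h1, h2, h3⟩ := hη.exists_curlVector hs0 hs1
    rw [← inner_curlVector u h1 h2 h3]
    exact h v (Submodule.subset_span ⟨η, hη, h1, h2, h3⟩)
  · intro h v hv
    induction hv using Submodule.span_induction with
    | mem v hv =>
      obtain ⟨η, hη, h1, h2, h3⟩ := hv
      rw [inner_curlVector u h1 h2 h3]
      exact h η hη
    | zero => exact inner_zero_right _
    | add v w _ _ hv hw => rw [inner_add_right, hv, hw, add_zero]
    | smul c v _ hv => rw [inner_smul_right, hv, mul_zero]

theorem memLp_weight_mul {s T : ℝ} (hs0 : 0 < s) (hs1 : s < 1) {g h : ℝ × ℝ → ℝ}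
    (hg : AEStronglyMeasurable g (volume.restrict (strip T)))
    (hi : IntegrableOn (fun p : ℝ × ℝ => p.2 ^ (1 - 2 * s) * h p) (strip T))
    (hgh : ∀ p, g p ^ 2 ≤ h p) :
    MemLp (fun p : ℝ × ℝ => weight s p.2 * g p) 2 (volume.restrict (strip T)) := by
  have hm : AEStronglyMeasurable (fun p : ℝ × ℝ => weight s p.2 * g p)
      (volume.restrict (strip T)) :=
    ((measurable_weight s).comp measurable_snd).aestronglyMeasurable.mul hg
  rw [memLp_two_iff_integrable_sq hm]
  refine (hi.const_mul (dConst s)).mono' (hm.pow 2) ?_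
  filter_upwards [ae_restrict_mem (measurableSet_strip T)] with p hp
  have hp2 : 0 < p.2 := hp.2
  rw [Real.norm_of_nonneg (sq_nonneg _), mul_pow, weight_sq hs0 hs1 hp2, mul_assoc]
  have h1 := dConst_pos hs0 hs1
  have h2 := hgh p
  gcongr

theorem HT.memLp_gradX {s T : ℝ} (hs0 : 0 < s) (hs1 : s < 1) (U : HT s T) :
    MemLp (fun p : ℝ × ℝ => weight s p.2 * U.gradX p) 2 (volume.restrict (strip T)) :=
  memLp_weight_mul hs0 hs1 U.gradX_meas U.finite_energy
    fun _ => le_add_of_nonneg_right (sq_nonneg _)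

theorem HT.memLp_gradY {s T : ℝ} (hs0 : 0 < s) (hs1 : s < 1) (U : HT s T) :
    MemLp (fun p : ℝ × ℝ => weight s p.2 * U.gradY p) 2 (volume.restrict (strip T)) :=
  memLp_weight_mul hs0 hs1 U.gradY_meas U.finite_energy
    fun _ => le_add_of_nonneg_left (sq_nonneg _)

/-- `u` is the triple `(w ∂_x U, w ∂_y U, U(·, 0))` of `U`. -/
structure Represents {s T : ℝ} (U : HT s T) (u : Ambient T) : Prop where
  gradX : u.fst =ᵐ[volume.restrict (strip T)] fun p => weight s p.2 * U.gradX p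
  gradY : u.snd.fst =ᵐ[volume.restrict (strip T)] fun p => weight s p.2 * U.gradY p
  trace : u.snd.snd = toL2 T U.trace

/-- Green's formula in `x` tested with `∂_y η` and in `y` tested with `∂_x η` have the same left
side, since mixed derivatives commute. Equating the right sides eliminates `U` and leaves the curl
condition. -/
theorem HT.exists_represents {s T : ℝ} (hs0 : 0 < s) (hs1 : s < 1) (U : HT s T) :
    ∃ u ∈ energySpace s T, Represents U u := by
  have m1 := U.memLp_gradX hs0 hs1
  have m2 := U.memLp_gradY hs0 hs1
  have hu : Represents U
      (WithLp.toLp 2 (m1.toLp, WithLp.toLp 2 (m2.toLp, toL2 T U.trace)) : Ambient T) :=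
    ⟨m1.coeFn_toLp, m2.coeFn_toLp, rfl⟩
  refine ⟨_, ?_, hu⟩
  rw [mem_energySpace_iff hs0 hs1]
  intro η hη
  have h1 := U.green_x _ (hη.fderiv_apply (0, 1))
  have h2 := U.green_y _ (hη.fderiv_apply (1, 0))
  simp only [hη.fderiv_comm _ (1, 0) (0, 1)] at h2
  rw [h1] at h2
  have e1 : ∀ (b c : ℝ × ℝ → ℝ) (f : Lp ℝ 2 (volume.restrict (strip T))),
      (f =ᵐ[volume.restrict (strip T)] fun p => weight s p.2 * b p) →
      ∫ p in strip T, f p * (c p / weight s p.2) = ∫ p in strip T, b p * c p := by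
    intro b c f hf
    refine integral_congr_ae ?_
    filter_upwards [hf, ae_restrict_mem (measurableSet_strip T)] with p hp hp2
    have := (weight_pos hs0 hs1 (show 0 < p.2 from hp2.2)).ne'
    rw [hp]
    field_simp
  rw [e1 _ (fun p => fderiv ℝ η p (0, 1)) _ hu.gradX,
    e1 _ (fun p => fderiv ℝ η p (1, 0)) _ hu.gradY]
  have e2 : ∫ x in period T, toL2 T U.trace x * fderiv ℝ η (x, 0) (1, 0) =
      ∫ x in period T, (U.trace : ℝ →ₘ[(volume : Measure ℝ)] ℝ) x * fderiv ℝ η (x, 0) (1, 0) := by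
    refine integral_congr_ae ?_
    filter_upwards [coeFn_toL2 U.trace] with x hx
    rw [hx]
  have e3 : ∫ x in period T, (WithLp.toLp 2 (m1.toLp, WithLp.toLp 2 (m2.toLp, toL2 T U.trace)) :
      Ambient T).snd.snd x * fderiv ℝ η (x, 0) (1, 0) =
      ∫ x in period T, toL2 T U.trace x * fderiv ℝ η (x, 0) (1, 0) := rfl
  rw [e3, e2]
  linarith

/-! ### Recovering a function from a triple in the energy space. -/

/-- The function on the half-plane that is periodic in `x` and agrees with `f` on the strip. -/
noncomputable def periodize {T : ℝ} (hT : 0 < T) (f : ℝ × ℝ → ℝ) (p : ℝ × ℝ) : ℝ :=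
  f (reduce hT p.1, p.2)

theorem periodize_add {T : ℝ} (hT : 0 < T) (f : ℝ × ℝ → ℝ) (x y : ℝ) :
    periodize hT f (x + T, y) = periodize hT f (x, y) := by
  simp only [periodize, reduce_add]

theorem periodize_of_mem {T : ℝ} (hT : 0 < T) (f : ℝ × ℝ → ℝ) {p : ℝ × ℝ} (hp : p.1 ∈ period T) :
    periodize hT f p = f p := by
  rw [periodize, reduce_of_mem hT hp]

theorem stronglyMeasurable_periodize {T : ℝ} (hT : 0 < T) {f : ℝ × ℝ → ℝ}
    (hf : StronglyMeasurable f) : StronglyMeasurable (periodize hT f) :=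
  hf.comp_measurable (((measurable_reduce hT).comp measurable_fst).prodMk measurable_snd)

/-- Cauchy-Schwarz: on a box of finite height both `f` and `1 / w` are square integrable. -/
theorem integrableOn_div_weight {s T : ℝ} (hs0 : 0 < s) (hs1 : s < 1)
    (f : Lp ℝ 2 ((volume : Measure (ℝ × ℝ)).restrict (strip T))) (R : ℝ) :
    IntegrableOn (fun p => f p / weight s p.2) (period T ×ˢ Ioc 0 R) := by
  have h1 : MemLp f 2 (volume.restrict (period T ×ˢ Ioc 0 R)) :=
    (Lp.memLp f).mono_measure (Measure.restrict_mono (box_subset_strip T R) le_rfl)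
  have h2 : MemLp (fun p : ℝ × ℝ => 1 / weight s p.2) 2
      (volume.restrict (period T ×ˢ Ioc 0 R)) := by
    have hm : Measurable fun p : ℝ × ℝ => 1 / weight s p.2 :=
      ((measurable_weight s).comp measurable_snd).const_div 1
    rw [memLp_two_iff_integrable_sq hm.aestronglyMeasurable, restrict_box]
    simpa using Integrable.mul_prod (integrable_const (1 : ℝ) (μ := volume.restrict (period T)))
      (integrableOn_inv_weight_sq hs0 hs1 R)
  refine (h1.integrable_mul h2).congr (.of_forall fun p => ?_)
  simp [div_eq_mul_inv]

/-- The function is the trace plus the primitive in `y` of the second field. Its Green formula in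
`y` holds by construction; the one in `x` is where the curl condition is used. -/
theorem exists_HT_represents {s T : ℝ} (hs0 : 0 < s) (hs1 : s < 1) (hT : 0 < T) {u : Ambient T}
    (hu : u ∈ energySpace s T) : ∃ U : HT s T, Represents U u := by
  rw [mem_energySpace_iff hs0 hs1] at hu
  obtain ⟨b₀, hb₀⟩ := toL2_surjective hT u.snd.snd
  let b : ℝ → ℝ := fun x => u.snd.snd (reduce hT x)
  let gx : ℝ × ℝ → ℝ := periodize hT fun p => u.fst p / weight s p.2
  let gy : ℝ × ℝ → ℝ := periodize hT fun p => u.snd.fst p / weight s p.2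
  have hb : StronglyMeasurable b :=
    (Lp.stronglyMeasurable u.snd.snd).comp_measurable (measurable_reduce hT)
  have hw : StronglyMeasurable fun p : ℝ × ℝ => weight s p.2 :=
    ((measurable_weight s).comp measurable_snd).stronglyMeasurable
  have hgx : StronglyMeasurable gx :=
    stronglyMeasurable_periodize hT ((Lp.stronglyMeasurable u.fst).div hw)
  have hgy : StronglyMeasurable gy :=
    stronglyMeasurable_periodize hT ((Lp.stronglyMeasurable u.snd.fst).div hw)
  have hgx' : ∀ p ∈ strip T, gx p = u.fst p / weight s p.2 :=
    fun p hp => periodize_of_mem hT _ hp.1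
  have hgy' : ∀ p ∈ strip T, gy p = u.snd.fst p / weight s p.2 :=
    fun p hp => periodize_of_mem hT _ hp.1
  have hb' : ∀ x ∈ period T, b x = u.snd.snd x := fun x hx => by simp only [b, reduce_of_mem hT hx]
  have hbi : IntegrableOn b (period T) :=
    (integrableOn_congr_fun hb' (measurableSet_period T)).2
      ((Lp.memLp u.snd.snd).integrable (by norm_num))
  have hgyi : ∀ R, IntegrableOn gy (period T ×ˢ Ioc 0 R) := fun R =>
    (integrableOn_congr_fun (fun p hp => hgy' p (box_subset_strip T R hp))
      (measurableSet_box T R)).2 (integrableOn_div_weight hs0 hs1 u.snd.fst R)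
  let W : ℝ × ℝ → ℝ := fun p => b p.1 + ∫ t in Ioc 0 p.2, gy (p.1, t)
  have hgreen : ∀ φ : ℝ × ℝ → ℝ, IsTest T φ → ∫ p in strip T, W p * fderiv ℝ φ p (0, 1) =
      -(∫ p in strip T, gy p * φ p) - ∫ x in period T, b x * φ (x, 0) :=
    fun φ hφ => green_primitive hb hbi hgy hgyi hφ
  have hsq : ∀ p ∈ strip T, p.2 ^ (1 - 2 * s) * (gx p ^ 2 + gy p ^ 2) =
      (dConst s)⁻¹ * (u.fst p ^ 2 + u.snd.fst p ^ 2) := by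
    intro p hp
    have hp2 : 0 < p.2 := hp.2
    have h1 := (weight_pos hs0 hs1 hp2).ne'
    have h2 := (dConst_pos hs0 hs1).ne'
    have h3 : p.2 ^ (1 - 2 * s) = (dConst s)⁻¹ * weight s p.2 ^ 2 := by
      rw [weight_sq hs0 hs1 hp2, inv_mul_cancel_left₀ h2]
    rw [hgx' p hp, hgy' p hp, h3]
    field_simp
  have hcancel : ∀ (f : Lp ℝ 2 ((volume : Measure (ℝ × ℝ)).restrict (strip T)))
      (g c : ℝ × ℝ → ℝ), (∀ p ∈ strip T, g p = f p / weight s p.2) →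
      ∫ p in strip T, f p * (c p / weight s p.2) = ∫ p in strip T, g p * c p := by
    intro f g c hg
    refine setIntegral_congr_fun (measurableSet_strip T) fun p hp => ?_
    simp only [hg p hp]
    ring
  let U : HT s T :=
    { toFun := W
      gradX := gx
      gradY := gy
      trace := b₀
      periodic := fun x y => by
        simp only [W, b, gy, periodize_add, reduce_add]
      gradX_periodic := periodize_add hT _
      gradY_periodic := periodize_add hT _
      integrableOn := integrableOn_primitive hb hbi hgy hgyi
      gradX_meas := hgx.aestronglyMeasurable
      gradY_meas := hgy.aestronglyMeasurable
      finite_energy := by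
        refine (integrableOn_congr_fun hsq (measurableSet_strip T)).2 ?_
        exact ((Lp.memLp u.fst).integrable_sq.add (Lp.memLp u.snd.fst).integrable_sq).const_mul _
      green_x := by
        intro φ hφ
        -- With `φ = ∂_y η` one has `∂_x φ = ∂_y ∂_x η`, so Green's formula in `y` applies to the
        -- test function `∂_x η`. The curl condition for `η` turns the result into `-∫∫ gx φ`.
        obtain ⟨η, hη, hηφ⟩ := hφ.exists_primitive
        have h1 : ∫ p in strip T, W p * fderiv ℝ φ p (1, 0) =
            ∫ p in strip T, W p * fderiv ℝ (fun q => fderiv ℝ η q (1, 0)) p (0, 1) := by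
          refine setIntegral_congr_fun (measurableSet_strip T) fun p hp => ?_
          have h2 : φ =ᶠ[nhds p] fun q => fderiv ℝ η q (0, 1) := by
            filter_upwards [(isOpen_lt continuous_const continuous_snd).mem_nhds
              (show (0 : ℝ) < p.2 from hp.2)] with q hq
            exact (hηφ q.1 q.2 hq).symm
          simp only [hη.fderiv_comm p (1, 0) (0, 1), h2.fderiv_eq]
        have h3 := hu η hη
        rw [hcancel _ gx (fun p => fderiv ℝ η p (0, 1)) hgx',
          hcancel _ gy (fun p => fderiv ℝ η p (1, 0)) hgy'] at h3
        have h4 : ∫ p in strip T, gx p * fderiv ℝ η p (0, 1) = ∫ p in strip T, gx p * φ p :=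
          setIntegral_congr_fun (measurableSet_strip T) fun p hp => by
            rw [← show fderiv ℝ η p (0, 1) = φ p from hηφ p.1 p.2 hp.2]
        have h5 : ∫ x in period T, u.snd.snd x * fderiv ℝ η (x, 0) (1, 0) =
            ∫ x in period T, b x * fderiv ℝ η (x, 0) (1, 0) :=
          setIntegral_congr_fun (measurableSet_period T) fun x hx => by
            simp only [hb' x hx]
        rw [h1, hgreen _ (hη.fderiv_apply (1, 0))]
        rw [h4, h5] at h3
        linarith
      green_y := by
        intro φ hφ
        rw [hgreen φ hφ]
        congr 1
        refine integral_congr_ae ?_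
        filter_upwards [coeFn_toL2 b₀, ae_restrict_mem (measurableSet_period T)] with x hx hx2
        rw [hb' x hx2, ← hx, hb₀] }
  refine ⟨U, ?_, ?_, hb₀.symm⟩
  · filter_upwards [ae_restrict_mem (measurableSet_strip T)] with p hp
    have h1 := (weight_pos hs0 hs1 (show 0 < p.2 from hp.2)).ne'
    rw [show U.gradX p = u.fst p / weight s p.2 from hgx' p hp]
    field_simp
  · filter_upwards [ae_restrict_mem (measurableSet_strip T)] with p hp
    have h1 := (weight_pos hs0 hs1 (show 0 < p.2 from hp.2)).ne'
    rw [show U.gradY p = u.snd.fst p / weight s p.2 from hgy' p hp]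
    field_simp

/-! ### Parseval's identity and averages in `y`. -/

/-- Parseval's identity on a period, in terms of cosines and sines. -/
theorem hasSum_cos_sin {T : ℝ} (hT : 0 < T) (h : Lp ℝ 2 ((volume : Measure ℝ).restrict (period T))) :
    HasSum (fun n : ℤ => (∫ x in period T, h x * Real.cos (2 * Real.pi * n / T * x)) ^ 2 +
      (∫ x in period T, h x * Real.sin (2 * Real.pi * n / T * x)) ^ 2) (T * ‖h‖ ^ 2) := by
  have hab : -(T / 2) < T / 2 := by linarith
  have hlen : T / 2 - -(T / 2) = T := by ring
  have hL : MemLp (fun x => (h x : ℂ)) 2 (volume.restrict (Ioc (-(T / 2)) (T / 2))) :=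
    (Lp.memLp h).ofReal
  have h1 := (hasSum_sq_fourierCoeffOn hab hL).mul_left (T ^ 2)
  have hi : ∀ {f : ℝ → ℝ}, Continuous f → Integrable (fun x => h x * f x)
      (volume.restrict (period T)) := fun hf => (Lp.memLp h).integrable_mul (memLp_slice hf)
  refine (congrArg₂ (fun (a : ℤ → ℝ) b => HasSum a b) ?_ ?_).mp h1
  · funext n
    symm
    set θ : ℝ := 2 * Real.pi * n / T
    have hc : Integrable (fun x => h x * Real.cos (θ * x)) (volume.restrict (period T)) :=
      hi (by fun_prop)
    have hs : Integrable (fun x => h x * Real.sin (θ * x)) (volume.restrict (period T)) :=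
      hi (by fun_prop)
    have h2 : fourierCoeffOn hab (fun x => (h x : ℂ)) n =
        ((T⁻¹ * ∫ x in period T, h x * Real.cos (θ * x) : ℝ) : ℂ) +
        ((-(T⁻¹ * ∫ x in period T, h x * Real.sin (θ * x)) : ℝ) : ℂ) * Complex.I := by
      rw [fourierCoeffOn_eq_integral, intervalIntegral.integral_of_le hab.le, hlen]
      have h3 : ∀ x : ℝ, fourier (-n) (x : AddCircle T) • (h x : ℂ) =
          ((h x * Real.cos (θ * x) : ℝ) : ℂ) -
            ((h x * Real.sin (θ * x) : ℝ) : ℂ) * Complex.I := by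
        intro x
        rw [fourier_coe_apply]
        have h4 : 2 * (Real.pi : ℂ) * Complex.I * ((-n : ℤ) : ℂ) * x / T =
            ((-(θ * x) : ℝ) : ℂ) * Complex.I := by
          simp only [θ]
          push_cast
          ring
        rw [h4, Complex.exp_mul_I, ← Complex.ofReal_cos, ← Complex.ofReal_sin, Real.cos_neg,
          Real.sin_neg, smul_eq_mul]
        push_cast
        ring
      simp only [h3]
      have h5 : ∫ x in Ioc (-(T / 2)) (T / 2), (((h x * Real.cos (θ * x) : ℝ) : ℂ) -
            ((h x * Real.sin (θ * x) : ℝ) : ℂ) * Complex.I) =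
          ((∫ x in period T, h x * Real.cos (θ * x) : ℝ) : ℂ) -
            ((∫ x in period T, h x * Real.sin (θ * x) : ℝ) : ℂ) * Complex.I := by
        rw [← integral_complex_ofReal, ← integral_complex_ofReal, ← integral_mul_const]
        exact integral_sub hc.ofReal (hs.ofReal.mul_const _)
      rw [h5, Complex.real_smul]
      push_cast
      ring
    rw [h2, Complex.sq_norm, Complex.normSq_add_mul_I]
    field_simp
  · rw [hlen, intervalIntegral.integral_of_le hab.le, smul_eq_mul, ← real_inner_self_eq_norm_sq,
      inner_Lp]
    have h3 : ∫ x in Ioc (-(T / 2)) (T / 2), ‖(h x : ℂ)‖ ^ 2 =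
        ∫ x in period T, h x * h x := by
      refine integral_congr_ae (.of_forall fun x => ?_)
      simp [sq]
    rw [h3]
    field_simp

theorem memLp_tensor {T : ℝ} {h ρ : ℝ → ℝ} (hh : MemLp h 2 (volume.restrict (period T)))
    (hρ : MemLp ρ 2 (volume.restrict (Ioi (0 : ℝ)))) :
    MemLp (fun p : ℝ × ℝ => h p.1 * ρ p.2) 2 (volume.restrict (strip T)) := by
  have hm : AEStronglyMeasurable (fun p : ℝ × ℝ => h p.1 * ρ p.2)
      ((volume.restrict (period T)).prod (volume.restrict (Ioi (0 : ℝ)))) :=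
    hh.1.comp_fst.mul hρ.1.comp_snd
  rw [restrict_strip, memLp_two_iff_integrable_sq hm]
  simpa only [mul_pow] using Integrable.mul_prod hh.integrable_sq hρ.integrable_sq

theorem ae_strip_of_ae_period {T : ℝ} {p : ℝ → Prop} (h : ∀ᵐ x ∂(volume.restrict (period T)), p x) :
    ∀ᵐ q ∂((volume : Measure (ℝ × ℝ)).restrict (strip T)), p q.1 := by
  rw [restrict_strip]
  exact Measure.quasiMeasurePreserving_fst.ae h

theorem norm_sq_Lp {α : Type*} [MeasurableSpace α] {μ : Measure α} (f : Lp ℝ 2 μ) :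
    ‖f‖ ^ 2 = ∫ x, f x ^ 2 ∂μ := by
  rw [← real_inner_self_eq_norm_sq, inner_Lp]
  simp only [sq]

/-- The operator `h ↦ h(x) ρ(y)` from functions on a period to functions on the strip. -/
noncomputable def tensorL (T : ℝ) {ρ : ℝ → ℝ} (hρ : MemLp ρ 2 (volume.restrict (Ioi (0 : ℝ)))) :
    Lp ℝ 2 ((volume : Measure ℝ).restrict (period T)) →L[ℝ]
      Lp ℝ 2 ((volume : Measure (ℝ × ℝ)).restrict (strip T)) :=
  LinearMap.mkContinuous
    { toFun := fun h => (memLp_tensor (Lp.memLp h) hρ).toLp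
      map_add' := fun f g => by
        rw [← MemLp.toLp_add]
        refine MemLp.toLp_congr _ _ ?_
        filter_upwards [ae_strip_of_ae_period (Lp.coeFn_add f g)] with p hp
        simp only [hp, Pi.add_apply, add_mul]
      map_smul' := fun c f => by
        rw [RingHom.id_apply, ← MemLp.toLp_const_smul]
        refine MemLp.toLp_congr _ _ ?_
        filter_upwards [ae_strip_of_ae_period (Lp.coeFn_smul c f)] with p hp
        simp only [hp, Pi.smul_apply, smul_eq_mul, mul_assoc] }
    √(∫ y in Ioi 0, ρ y ^ 2) (fun h => by
      refine le_of_sq_le_sq ?_ (by positivity)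
      rw [mul_pow, Real.sq_sqrt (integral_nonneg fun _ => sq_nonneg _), norm_sq_Lp, norm_sq_Lp]
      have h1 : ∫ p in strip T, MemLp.toLp _ (memLp_tensor (Lp.memLp h) hρ) p ^ 2 =
          ∫ p in strip T, h p.1 ^ 2 * ρ p.2 ^ 2 := by
        refine integral_congr_ae ?_
        filter_upwards [(memLp_tensor (Lp.memLp h) hρ).coeFn_toLp] with p hp
        rw [hp, mul_pow]
      refine le_of_eq (h1.trans ?_)
      rw [restrict_strip, integral_prod_mul (fun x => h x ^ 2) (fun y => ρ y ^ 2), mul_comm])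

theorem coeFn_tensorL {T : ℝ} {ρ : ℝ → ℝ} (hρ : MemLp ρ 2 (volume.restrict (Ioi (0 : ℝ))))
    (h : Lp ℝ 2 ((volume : Measure ℝ).restrict (period T))) :
    tensorL T hρ h =ᵐ[volume.restrict (strip T)] fun p => h p.1 * ρ p.2 :=
  (memLp_tensor (Lp.memLp h) hρ).coeFn_toLp

/-- The operator `f ↦ ∫ f(·, y) ρ(y) dy` from functions on the strip to functions on a period. -/
noncomputable def averageL (T : ℝ) {ρ : ℝ → ℝ} (hρ : MemLp ρ 2 (volume.restrict (Ioi (0 : ℝ)))) :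
    Lp ℝ 2 ((volume : Measure (ℝ × ℝ)).restrict (strip T)) →L[ℝ]
      Lp ℝ 2 ((volume : Measure ℝ).restrict (period T)) :=
  (tensorL T hρ).adjoint

/-- An adjoint has the norm of the original operator, and `tensorL` is bounded by the `L²` norm of
`ρ`. -/
theorem norm_averageL_sq_le {T : ℝ} {ρ : ℝ → ℝ} (hρ : MemLp ρ 2 (volume.restrict (Ioi (0 : ℝ))))
    (f : Lp ℝ 2 ((volume : Measure (ℝ × ℝ)).restrict (strip T))) :
    ‖averageL T hρ f‖ ^ 2 ≤ (∫ y in Ioi 0, ρ y ^ 2) * ‖f‖ ^ 2 := by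
  have h1 : ‖averageL T hρ‖ ≤ √(∫ y in Ioi 0, ρ y ^ 2) := by
    rw [averageL, LinearIsometryEquiv.norm_map]
    exact LinearMap.mkContinuous_norm_le _ (Real.sqrt_nonneg _) _
  have h2 : ‖averageL T hρ f‖ ≤ √(∫ y in Ioi 0, ρ y ^ 2) * ‖f‖ :=
    (ContinuousLinearMap.le_opNorm _ _).trans (by gcongr)
  calc ‖averageL T hρ f‖ ^ 2 ≤ (√(∫ y in Ioi 0, ρ y ^ 2) * ‖f‖) ^ 2 := by gcongr
    _ = _ := by rw [mul_pow, Real.sq_sqrt (integral_nonneg fun _ => sq_nonneg _)]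

theorem integral_averageL_mul {T : ℝ} {ρ : ℝ → ℝ} (hρ : MemLp ρ 2 (volume.restrict (Ioi (0 : ℝ))))
    (f : Lp ℝ 2 ((volume : Measure (ℝ × ℝ)).restrict (strip T))) {h : ℝ → ℝ} (hh : Continuous h) :
    ∫ x in period T, averageL T hρ f x * h x = ∫ p in strip T, f p * (h p.1 * ρ p.2) := by
  have hm : MemLp h 2 (volume.restrict (period T)) := memLp_slice hh
  have h1 := ContinuousLinearMap.adjoint_inner_left (tensorL T hρ) hm.toLp f
  rw [inner_Lp, inner_Lp] at h1
  refine Eq.trans ?_ (h1.trans ?_)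
  · refine integral_congr_ae ?_
    filter_upwards [hm.coeFn_toLp] with x hx
    rw [hx]
    rfl
  · refine integral_congr_ae ?_
    filter_upwards [coeFn_tensorL hρ hm.toLp, ae_strip_of_ae_period hm.coeFn_toLp] with p hp hp2
    rw [hp, hp2]

/-! ### The trace operator on the energy space. -/

/-- The Hilbert space of `energySpace s T` as a type. -/
def Energy (s T : ℝ) : Type := energySpace s T

namespace Energy

variable {s T : ℝ}

noncomputable instance : NormedAddCommGroup (Energy s T) :=
  inferInstanceAs (NormedAddCommGroup (energySpace s T))

noncomputable instance : InnerProductSpace ℝ (Energy s T) :=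
  inferInstanceAs (InnerProductSpace ℝ (energySpace s T))

instance : CompleteSpace (Energy s T) := inferInstanceAs (CompleteSpace (energySpace s T))

/-- The triple underlying an element of the energy space. -/
def toAmbient (u : Energy s T) : Ambient T := (show energySpace s T from u).1

theorem toAmbient_mem (u : Energy s T) : u.toAmbient ∈ energySpace s T :=
  (show energySpace s T from u).2

theorem exists_toAmbient_eq {u : Ambient T} (hu : u ∈ energySpace s T) :
    ∃ v : Energy s T, v.toAmbient = u := ⟨(⟨u, hu⟩ : energySpace s T), rfl⟩

theorem inner_eq (u v : Energy s T) : inner ℝ u v = inner ℝ u.toAmbient v.toAmbient := rfl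

theorem norm_eq (u : Energy s T) : ‖u‖ = ‖u.toAmbient‖ := rfl

end Energy

/-- The trace of an element of the energy space. -/
noncomputable def traceL (s T : ℝ) :
    Energy s T →L[ℝ] Lp ℝ 2 ((volume : Measure ℝ).restrict (period T)) :=
  LinearMap.mkContinuous
    { toFun := fun u => u.toAmbient.snd.snd
      map_add' := fun _ _ => rfl
      map_smul' := fun _ _ => rfl } 1 (fun u => by
      rw [one_mul]
      exact (WithLp.norm_snd_le _ _).trans (WithLp.norm_snd_le _ _))

theorem traceL_apply {s T : ℝ} (u : Energy s T) : traceL s T u = u.toAmbient.snd.snd := rfl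

theorem norm_sq_ambient {T : ℝ} (u : Ambient T) :
    ‖u‖ ^ 2 = ‖u.fst‖ ^ 2 + (‖u.snd.fst‖ ^ 2 + ‖u.snd.snd‖ ^ 2) := by
  simp only [← real_inner_self_eq_norm_sq, inner_ambient]

/-- For a cutoff, with `C = 1`, the explicit bound tends to zero with `δ`; for its derivative only
membership in `L²` is needed. -/
theorem memLp_div_weight_Ioi {s : ℝ} (hs0 : 0 < s) (hs1 : s < 1) {q : ℝ → ℝ} (hq : Continuous q)
    {δ C : ℝ} (hv : ∀ y, δ ≤ y → q y = 0) (hC : ∀ y, 0 < y → |q y| ≤ C) :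
    MemLp (fun y => q y / weight s y) 2 (volume.restrict (Ioi (0 : ℝ))) ∧
      ∫ y in Ioi 0, (q y / weight s y) ^ 2 ≤ C ^ 2 * ∫ y in Ioc 0 δ, (1 / weight s y) ^ 2 := by
  have hm : Measurable (fun y => q y / weight s y) := hq.measurable.div (measurable_weight s)
  have h1 : IntegrableOn (fun y => (Ioc 0 δ).indicator (fun y => C ^ 2 * (1 / weight s y) ^ 2) y)
      (Ioi 0) := by
    have h0 : IntegrableOn (fun y => C ^ 2 * (1 / weight s y) ^ 2) (Ioc 0 δ) :=
      (integrableOn_inv_weight_sq hs0 hs1 δ).const_mul _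
    exact (h0.integrable_indicator measurableSet_Ioc).integrableOn
  have h2 : ∀ y ∈ Ioi (0 : ℝ), (q y / weight s y) ^ 2 ≤
      (Ioc 0 δ).indicator (fun y => C ^ 2 * (1 / weight s y) ^ 2) y := by
    intro y hy
    rcases le_or_gt δ y with h | h
    · rw [hv y h, zero_div, zero_pow two_ne_zero]
      exact indicator_nonneg (fun _ _ => by positivity) _
    · rw [indicator_of_mem (show y ∈ Ioc 0 δ from ⟨hy, h.le⟩), div_pow, one_div, inv_pow,
        ← div_eq_mul_inv]
      exact div_le_div_of_nonneg_right
        (sq_le_sq' (abs_le.1 (hC y hy)).1 (abs_le.1 (hC y hy)).2) (sq_nonneg _)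
  have h3 : IntegrableOn (fun y => (q y / weight s y) ^ 2) (Ioi 0) := by
    refine Integrable.mono' h1 (hm.pow_const 2).aestronglyMeasurable ?_
    filter_upwards [ae_restrict_mem measurableSet_Ioi] with y hy
    rw [Real.norm_of_nonneg (sq_nonneg _)]
    exact h2 y hy
  refine ⟨(memLp_two_iff_integrable_sq hm.aestronglyMeasurable).2 h3, ?_⟩
  refine (setIntegral_mono_on h3 h1 measurableSet_Ioi h2).trans_eq ?_
  rw [setIntegral_indicator measurableSet_Ioc, inter_eq_self_of_subset_right Ioc_subset_Ioi_self,
    integral_const_mul]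

/-! ### Compactness of the trace by cutoffs and Fourier series. -/

/-- A smooth cutoff function, equal to one at zero and vanishing beyond `δ`. -/
noncomputable def cutoff (δ y : ℝ) : ℝ := Real.smoothTransition (1 - y / δ)

theorem contDiff_cutoff (δ : ℝ) : ContDiff ℝ ∞ (cutoff δ) :=
  Real.smoothTransition.contDiff.comp (contDiff_const.sub (contDiff_id.div_const δ))

theorem cutoff_zero (δ : ℝ) : cutoff δ 0 = 1 := by simp [cutoff]

theorem cutoff_of_le {δ y : ℝ} (hδ : 0 < δ) (hy : δ ≤ y) : cutoff δ y = 0 :=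
  Real.smoothTransition.zero_of_nonpos (sub_nonpos.2 ((one_le_div hδ).2 hy))

theorem abs_cutoff_le (δ y : ℝ) : |cutoff δ y| ≤ 1 := by
  rw [cutoff, abs_of_nonneg (Real.smoothTransition.nonneg _)]
  exact Real.smoothTransition.le_one _

theorem hasDerivAt_cutoff (δ y : ℝ) : HasDerivAt (cutoff δ) (deriv (cutoff δ) y) y :=
  ((contDiff_cutoff δ).differentiable (by simp)).differentiableAt.hasDerivAt

theorem continuous_deriv_cutoff (δ : ℝ) : Continuous (deriv (cutoff δ)) :=
  (contDiff_cutoff δ).continuous_deriv (by simp)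

theorem deriv_cutoff_of_le {δ y : ℝ} (hδ : 0 < δ) (hy : δ + 1 ≤ y) : deriv (cutoff δ) y = 0 := by
  have h : cutoff δ =ᶠ[nhds y] fun _ => 0 := by
    filter_upwards [Ioi_mem_nhds (show δ < y by linarith)] with z hz
    exact cutoff_of_le hδ (le_of_lt hz)
  rw [h.deriv_eq, deriv_const]

theorem exists_abs_deriv_cutoff_le {δ : ℝ} (hδ : 0 < δ) :
    ∃ C, ∀ y, 0 < y → |deriv (cutoff δ) y| ≤ C := by
  obtain ⟨C, hC⟩ := (isCompact_Icc (a := 0) (b := δ + 1)).exists_bound_of_continuousOn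
    (continuous_deriv_cutoff δ).continuousOn
  refine ⟨max C 0, fun y hy => ?_⟩
  rcases le_total (δ + 1) y with h | h
  · simp [deriv_cutoff_of_le hδ h]
  · exact (hC y ⟨hy.le, h⟩).trans (le_max_left _ _)

/-- The curl condition tested with a product of a periodic function and a cutoff. -/
theorem trace_add_average_mul {s T δ : ℝ} (hs0 : 0 < s) (hs1 : s < 1) (hδ : 0 < δ)
    (h₁ : MemLp (fun y => deriv (cutoff δ) y / weight s y) 2 (volume.restrict (Ioi (0 : ℝ))))
    (h₀ : MemLp (fun y => cutoff δ y / weight s y) 2 (volume.restrict (Ioi (0 : ℝ))))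
    (u : Energy s T) {f f' : ℝ → ℝ} (hf : ContDiff ℝ ∞ f) (hfT : Function.Periodic f T)
    (hff' : ∀ x, HasDerivAt f (f' x) x) (hf' : Continuous f') :
    (∫ x in period T, averageL T h₁ u.toAmbient.fst x * f x)
      - (∫ x in period T, averageL T h₀ u.toAmbient.snd.fst x * f' x)
      - ∫ x in period T, traceL s T u x * f' x = 0 := by
  -- As `χ(0) = 1`, the boundary term of the curl condition for `η` is the trace tested with `f'`.
  let η : ℝ × ℝ → ℝ := fun p => f p.1 * cutoff δ p.2
  have hη : IsTest T η :=
    { smooth := (hf.comp contDiff_fst).mul ((contDiff_cutoff δ).comp contDiff_snd)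
      periodic := fun x y => by simp only [η, hfT x]
      vanishes := ⟨δ, fun x y hy => by simp only [η, cutoff_of_le hδ hy, mul_zero]⟩ }
  have hd : ∀ p : ℝ × ℝ, HasFDerivAt η (fderiv ℝ η p) p := fun p =>
    (hη.smooth.differentiable (by simp)).differentiableAt.hasFDerivAt
  have hx : ∀ p : ℝ × ℝ, fderiv ℝ η p (1, 0) = f' p.1 * cutoff δ p.2 := fun p => by
    have h0 : HasDerivAt (fun x : ℝ => (x, p.2)) ((1 : ℝ), (0 : ℝ)) p.1 :=
      (hasDerivAt_id p.1).prodMk (hasDerivAt_const p.1 p.2)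
    have h : HasDerivAt (η ∘ fun x : ℝ => (x, p.2)) (fderiv ℝ η p (1, 0)) p.1 :=
      (hd p).comp_hasDerivAt p.1 h0
    exact h.unique ((hff' p.1).mul_const (cutoff δ p.2))
  have hy : ∀ p : ℝ × ℝ, fderiv ℝ η p (0, 1) = f p.1 * deriv (cutoff δ) p.2 := fun p => by
    have h0 : HasDerivAt (fun y : ℝ => (p.1, y)) ((0 : ℝ), (1 : ℝ)) p.2 :=
      (hasDerivAt_const p.2 p.1).prodMk (hasDerivAt_id p.2)
    have h : HasDerivAt (η ∘ fun y : ℝ => (p.1, y)) (fderiv ℝ η p (0, 1)) p.2 :=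
      (hd p).comp_hasDerivAt p.2 h0
    exact h.unique ((hasDerivAt_cutoff δ p.2).const_mul (f p.1))
  have h := (mem_energySpace_iff hs0 hs1 u.toAmbient).1 u.toAmbient_mem η hη
  simp only [hx, hy, cutoff_zero, mul_one] at h
  rw [integral_averageL_mul h₁ _ hf.continuous, integral_averageL_mul h₀ _ hf']
  simpa only [mul_div_assoc, traceL_apply] using h

/-- The relation `(t u + P)' = -Q` read on Fourier coefficients, by testing with `cos (θ x)` and
`sin (θ x)`; both are `T`-periodic since `θ T` is a multiple of `2π`. -/
theorem trace_fourier {s T δ : ℝ} (hs0 : 0 < s) (hs1 : s < 1) (hT : 0 < T) (hδ : 0 < δ)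
    (h₁ : MemLp (fun y => deriv (cutoff δ) y / weight s y) 2 (volume.restrict (Ioi (0 : ℝ))))
    (h₀ : MemLp (fun y => cutoff δ y / weight s y) 2 (volume.restrict (Ioi (0 : ℝ))))
    (u : Energy s T) (n : ℤ) {θ : ℝ} (hθ : θ = 2 * Real.pi * n / T) :
    (∫ x in period T, averageL T h₁ u.toAmbient.fst x * Real.cos (θ * x))
      + θ * (∫ x in period T, averageL T h₀ u.toAmbient.snd.fst x * Real.sin (θ * x))
      + θ * (∫ x in period T, traceL s T u x * Real.sin (θ * x)) = 0 ∧
    (∫ x in period T, averageL T h₁ u.toAmbient.fst x * Real.sin (θ * x))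
      - θ * (∫ x in period T, averageL T h₀ u.toAmbient.snd.fst x * Real.cos (θ * x))
      - θ * (∫ x in period T, traceL s T u x * Real.cos (θ * x)) = 0 := by
  have hper : ∀ x, θ * (x + T) = θ * x + n * (2 * Real.pi) := by
    intro x
    rw [hθ]
    field_simp
  have hlin : ∀ x : ℝ, HasDerivAt (fun x => θ * x) θ x := fun x => by
    simpa using (hasDerivAt_id x).const_mul θ
  have hpull : ∀ (h : Lp ℝ 2 ((volume : Measure ℝ).restrict (period T))) (c : ℝ) (f : ℝ → ℝ),
      ∫ x in period T, h x * (c * f x) = c * ∫ x in period T, h x * f x := by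
    intro h c f
    rw [← integral_const_mul]
    congr 1
    funext x
    ring
  constructor
  · have h := trace_add_average_mul hs0 hs1 hδ h₁ h₀ u (f := fun x => Real.cos (θ * x))
      (f' := fun x => -θ * Real.sin (θ * x)) (by fun_prop)
      (fun x => by simp only [hper, Real.cos_add_int_mul_two_pi])
      (fun x => by simpa [mul_comm] using (hlin x).cos) (by fun_prop)
    rw [hpull, hpull] at h
    linarith
  · have h := trace_add_average_mul hs0 hs1 hδ h₁ h₀ u (f := fun x => Real.sin (θ * x))
      (f' := fun x => θ * Real.cos (θ * x)) (by fun_prop)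
      (fun x => by simp only [hper, Real.sin_add_int_mul_two_pi])
      (fun x => by simpa [mul_comm] using (hlin x).sin) (by fun_prop)
    rw [hpull, hpull] at h
    linarith

/-- If the low Fourier coefficients of the trace vanish, the trace is controlled by averages of
the gradient. -/
theorem norm_trace_sq_le {s T δ : ℝ} (hs0 : 0 < s) (hs1 : s < 1) (hT : 0 < T) (hδ : 0 < δ)
    (h₁ : MemLp (fun y => deriv (cutoff δ) y / weight s y) 2 (volume.restrict (Ioi (0 : ℝ))))
    (h₀ : MemLp (fun y => cutoff δ y / weight s y) 2 (volume.restrict (Ioi (0 : ℝ))))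
    (u : Energy s T) (N : ℕ)
    (hu : ∀ n : ℤ, |n| ≤ N →
      ∫ x in period T, traceL s T u x * Real.cos (2 * Real.pi * n / T * x) = 0 ∧
      ∫ x in period T, traceL s T u x * Real.sin (2 * Real.pi * n / T * x) = 0) :
    ‖traceL s T u‖ ^ 2 ≤ 2 * ‖averageL T h₀ u.toAmbient.snd.fst‖ ^ 2 +
      2 * (T / (2 * Real.pi * (N + 1))) ^ 2 * ‖averageL T h₁ u.toAmbient.fst‖ ^ 2 := by
  set P := averageL T h₀ u.toAmbient.snd.fst
  set Q := averageL T h₁ u.toAmbient.fst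
  set κ : ℝ := T / (2 * Real.pi * (N + 1))
  have hκ : 0 < κ := by positivity
  -- By Parseval it suffices to compare the two sides frequency by frequency.
  have hsum := ((hasSum_cos_sin hT P).mul_left 2).add ((hasSum_cos_sin hT Q).mul_left (2 * κ ^ 2))
  have hle := hasSum_le (fun n => ?_) (hasSum_cos_sin hT (traceL s T u)) hsum
  · have h1 : T * ‖traceL s T u‖ ^ 2 ≤ T * (2 * ‖P‖ ^ 2 + 2 * κ ^ 2 * ‖Q‖ ^ 2) := by linarith
    exact le_of_mul_le_mul_left h1 hT
  · rcases le_or_gt |n| (N : ℤ) with hn | hn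
    · rw [(hu n hn).1, (hu n hn).2]
      simp only [ne_eq, OfNat.ofNat_ne_zero, not_false_eq_true, zero_pow, add_zero]
      positivity
    · obtain ⟨e1, e2⟩ := trace_fourier hs0 hs1 hT hδ h₁ h₀ u n rfl
      set θ : ℝ := 2 * Real.pi * n / T with hθ
      have hn' : ((N : ℝ) + 1) ^ 2 ≤ (n : ℝ) ^ 2 := by
        have h2 : (N : ℤ) + 1 ≤ |n| := hn
        have h3 : ((N : ℤ) + 1) ^ 2 ≤ n ^ 2 := by
          rw [← sq_abs n]
          exact pow_le_pow_left₀ (by positivity) h2 2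
        exact_mod_cast h3
      -- The constant `κ` is the reciprocal of the first frequency not excluded, the one with `n = N
      -- + 1`.
      have hκθ : 1 ≤ κ ^ 2 * θ ^ 2 := by
        have h4 : κ ^ 2 * θ ^ 2 = (n : ℝ) ^ 2 / ((N : ℝ) + 1) ^ 2 := by
          simp only [κ, hθ]
          field_simp
        rw [h4, one_le_div (by positivity)]
        exact hn'
      have hθ0 : 0 < θ ^ 2 := by
        by_contra h
        have : θ ^ 2 = 0 := le_antisymm (not_lt.1 h) (sq_nonneg _)
        rw [this, mul_zero] at hκθ
        linarith
      set c := ∫ x in period T, traceL s T u x * Real.cos (θ * x)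
      set d := ∫ x in period T, traceL s T u x * Real.sin (θ * x)
      set cP := ∫ x in period T, P x * Real.cos (θ * x)
      set dP := ∫ x in period T, P x * Real.sin (θ * x)
      set cQ := ∫ x in period T, Q x * Real.cos (θ * x)
      set dQ := ∫ x in period T, Q x * Real.sin (θ * x)
      -- The two Fourier relations give `θ c` and `θ d`; the factors `2` come from `(p + q)² ≤ 2 p²
      -- + 2 q²`.
      have h5 : θ ^ 2 * (c ^ 2 + d ^ 2) ≤
          2 * θ ^ 2 * (cP ^ 2 + dP ^ 2) + 2 * (cQ ^ 2 + dQ ^ 2) := by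
        have i1 : θ * d = -(cQ + θ * dP) := by linarith
        have i2 : θ * c = dQ - θ * cP := by linarith
        calc θ ^ 2 * (c ^ 2 + d ^ 2) = (θ * c) ^ 2 + (θ * d) ^ 2 := by ring
          _ = (dQ - θ * cP) ^ 2 + (cQ + θ * dP) ^ 2 := by rw [i1, i2, neg_sq]
          _ ≤ _ := by nlinarith [sq_nonneg (dQ + θ * cP), sq_nonneg (cQ - θ * dP)]
      refine le_of_mul_le_mul_left (h5.trans ?_) hθ0
      have h6 : 0 ≤ cQ ^ 2 + dQ ^ 2 := by positivity
      nlinarith [mul_le_mul_of_nonneg_right hκθ h6]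

theorem exists_small_height {s : ℝ} (hs0 : 0 < s) {ε : ℝ} (hε : 0 < ε) : ∃ δ : ℝ, 0 < δ ∧
    2 * ((dConst s)⁻¹ * (δ ^ (2 * s) / (2 * s))) ≤ ε := by
  have h1 : Filter.Tendsto (fun δ : ℝ => 2 * ((dConst s)⁻¹ * (δ ^ (2 * s) / (2 * s))))
      (nhdsWithin 0 (Ioi 0)) (nhds 0) := by
    have h2 : ContinuousAt (fun δ : ℝ => 2 * ((dConst s)⁻¹ * (δ ^ (2 * s) / (2 * s)))) 0 :=
      (((Real.continuousAt_rpow_const 0 (2 * s) (Or.inr (by positivity))).div_const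
        _).const_mul _).const_mul _
    have h3 := h2.tendsto
    simp only [Real.zero_rpow (show 2 * s ≠ 0 by positivity), zero_div, mul_zero] at h3
    exact h3.mono_left nhdsWithin_le_nhds
  obtain ⟨δ, h4, h5⟩ := ((h1.eventually_le_const hε).and self_mem_nhdsWithin).exists
  exact ⟨δ, h5, h4⟩

theorem exists_large_frequency (T B : ℝ) {ε : ℝ} (hε : 0 < ε) :
    ∃ N : ℕ, 2 * (T / (2 * Real.pi * (N + 1))) ^ 2 * B ≤ ε := by
  have h1 : Filter.Tendsto (fun N : ℕ => 2 * (T / (2 * Real.pi) * (1 / ((N : ℝ) + 1))) ^ 2 * B)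
      Filter.atTop (nhds (2 * (T / (2 * Real.pi) * 0) ^ 2 * B)) :=
    (((tendsto_one_div_add_atTop_nhds_zero_nat.const_mul _).pow 2).const_mul _).mul_const _
  simp only [mul_zero, ne_eq, OfNat.ofNat_ne_zero, not_false_eq_true, zero_pow, zero_mul] at h1
  obtain ⟨N, hN⟩ := (h1.eventually_le_const hε).exists
  refine ⟨N, le_of_eq_of_le ?_ hN⟩
  rw [div_mul_div_comm, mul_one]

/-- The trace is small on functions whose trace has no low frequencies. -/
theorem exists_norm_trace_le {s T : ℝ} (hs0 : 0 < s) (hs1 : s < 1) (hT : 0 < T) {ε : ℝ}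
    (hε : 0 < ε) : ∃ N : ℕ, ∀ u : Energy s T,
      (∀ n : ℤ, |n| ≤ N →
        ∫ x in period T, traceL s T u x * Real.cos (2 * Real.pi * n / T * x) = 0 ∧
        ∫ x in period T, traceL s T u x * Real.sin (2 * Real.pi * n / T * x) = 0) →
      ‖traceL s T u‖ ≤ ε * ‖u‖ := by
  -- The order matters: `δ` is fixed first to make the `∂_y` part small. Only then is `N` chosen,
  -- since the constant in front of the `∂_x` part depends on `δ`.
  obtain ⟨δ, hδ, hδε⟩ := exists_small_height hs0 (show 0 < ε ^ 2 / 2 by positivity)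
  obtain ⟨C, hC⟩ := exists_abs_deriv_cutoff_le hδ
  obtain ⟨m₀, b₀⟩ := memLp_div_weight_Ioi hs0 hs1 (contDiff_cutoff δ).continuous
    (fun y => cutoff_of_le hδ) (fun y _ => abs_cutoff_le δ y)
  obtain ⟨m₁, -⟩ := memLp_div_weight_Ioi hs0 hs1 (continuous_deriv_cutoff δ)
    (fun y => deriv_cutoff_of_le hδ) hC
  rw [one_pow, one_mul, setIntegral_inv_weight_sq hs0 hs1 hδ.le] at b₀
  obtain ⟨N, hN⟩ := exists_large_frequency T
    (∫ y in Ioi 0, (deriv (cutoff δ) y / weight s y) ^ 2) (show 0 < ε ^ 2 / 2 by positivity)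
  refine ⟨N, fun u hu => ?_⟩
  have h1 := norm_trace_sq_le hs0 hs1 hT hδ m₁ m₀ u N hu
  have h2 := norm_averageL_sq_le m₀ u.toAmbient.snd.fst
  have h3 := norm_averageL_sq_le m₁ u.toAmbient.fst
  have h4 := norm_sq_ambient u.toAmbient
  have h5 := u.norm_eq
  refine le_of_sq_le_sq ?_ (by positivity)
  rw [mul_pow, h5, h4]
  set B : ℝ := ∫ y in Ioi 0, (deriv (cutoff δ) y / weight s y) ^ 2
  set A : ℝ := ∫ y in Ioi 0, (cutoff δ y / weight s y) ^ 2
  set a := ‖u.toAmbient.fst‖ ^ 2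
  set b := ‖u.toAmbient.snd.fst‖ ^ 2
  set c := ‖u.toAmbient.snd.snd‖ ^ 2
  set κ := (T / (2 * Real.pi * (N + 1))) ^ 2
  have ha : 0 ≤ a := sq_nonneg _
  have hb : 0 ≤ b := sq_nonneg _
  have hc : 0 ≤ c := sq_nonneg _
  have hκ : 0 ≤ κ := sq_nonneg _
  calc ‖traceL s T u‖ ^ 2 ≤ 2 * (A * b) + 2 * κ * (B * a) := by
        refine h1.trans (add_le_add ?_ ?_)
        · exact mul_le_mul_of_nonneg_left h2 zero_le_two
        · exact mul_le_mul_of_nonneg_left h3 (mul_nonneg zero_le_two hκ)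
    _ = (2 * A) * b + (2 * κ * B) * a := by ring
    _ ≤ ε ^ 2 / 2 * b + ε ^ 2 / 2 * a :=
        add_le_add (mul_le_mul_of_nonneg_right (by linarith) hb)
          (mul_le_mul_of_nonneg_right hN ha)
    _ ≤ ε ^ 2 * (a + (b + c)) := by
        have e1 := mul_nonneg (sq_nonneg ε) ha
        have e2 := mul_nonneg (sq_nonneg ε) hb
        have e3 := mul_nonneg (sq_nonneg ε) hc
        linarith

/-- The trace operator is compact. -/
theorem isCompactOperator_traceL {s T : ℝ} (hs0 : 0 < s) (hs1 : s < 1) (hT : 0 < T) :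
    IsCompactOperator (traceL s T) := by
  refine isCompactOperator_of_small_on_orthogonal (H := Energy s T)
    (L := Lp ℝ 2 ((volume : Measure ℝ).restrict (period T))) (traceL s T) fun ε hε => ?_
  obtain ⟨N, hN⟩ := exists_norm_trace_le hs0 hs1 hT hε
  have mc : ∀ n : ℤ, MemLp (fun x => Real.cos (2 * Real.pi * n / T * x)) 2
      (volume.restrict (period T)) := fun n => memLp_slice (by fun_prop)
  have ms : ∀ n : ℤ, MemLp (fun x => Real.sin (2 * Real.pi * n / T * x)) 2
      (volume.restrict (period T)) := fun n => memLp_slice (by fun_prop)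
  -- The finitely many vectors to be avoided are the cosines and sines of frequency at most `N`.
  let F : Set (Lp ℝ 2 ((volume : Measure ℝ).restrict (period T))) :=
    (fun n => (mc n).toLp) '' Icc (-(N : ℤ)) N ∪ (fun n => (ms n).toLp) '' Icc (-(N : ℤ)) N
  refine ⟨F, ((finite_Icc _ _).image _).union ((finite_Icc _ _).image _), fun u hu => ?_⟩
  have hval : ∀ {f : ℝ → ℝ} (hf : MemLp f 2 (volume.restrict (period T))),
      hf.toLp ∈ F → ∫ x in period T, traceL s T u x * f x = 0 := by
    intro f hf hF
    have h1 := hu _ hF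
    rw [inner_Lp] at h1
    rw [← h1]
    refine integral_congr_ae ?_
    filter_upwards [hf.coeFn_toLp] with x hx
    rw [hx, mul_comm]
  exact hN u fun n hn => ⟨hval (mc n) (Or.inl ⟨n, abs_le.1 hn, rfl⟩),
    hval (ms n) (Or.inr ⟨n, abs_le.1 hn, rfl⟩)⟩

/-! ### The bilinear form and weak solutions in Hilbert space terms. -/

section Multiplier

variable {α : Type*} [MeasurableSpace α] {μ : Measure α}

theorem memLp_mul_of_bound {m f : α → ℝ} (hm : AEStronglyMeasurable m μ) {C : ℝ}
    (hC : ∀ x, |m x| ≤ C) (hf : MemLp f 2 μ) : MemLp (fun x => m x * f x) 2 μ :=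
  hf.of_le_mul (c := C) (hm.mul hf.1) (.of_forall fun x => by
    rw [norm_mul]
    exact mul_le_mul_of_nonneg_right (hC x) (norm_nonneg _))

/-- Multiplication by a bounded measurable function, as an operator on `L²`. -/
noncomputable def mulL {m : α → ℝ} (hm : AEStronglyMeasurable m μ) {C : ℝ} (hC : ∀ x, |m x| ≤ C) :
    Lp ℝ 2 μ →L[ℝ] Lp ℝ 2 μ :=
  LinearMap.mkContinuous
    { toFun := fun f => (memLp_mul_of_bound hm hC (Lp.memLp f)).toLp
      map_add' := fun f g => by
        rw [← MemLp.toLp_add]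
        refine MemLp.toLp_congr _ _ ?_
        filter_upwards [Lp.coeFn_add f g] with p hp
        simp only [hp, Pi.add_apply, mul_add]
      map_smul' := fun c f => by
        rw [RingHom.id_apply, ← MemLp.toLp_const_smul]
        refine MemLp.toLp_congr _ _ ?_
        filter_upwards [Lp.coeFn_smul c f] with p hp
        simp only [hp, Pi.smul_apply, smul_eq_mul, mul_left_comm] }
    C (fun f => by
      refine Lp.norm_le_mul_norm_of_ae_le_mul ?_
      filter_upwards [(memLp_mul_of_bound hm hC (Lp.memLp f)).coeFn_toLp] with x hx
      refine (congrArg norm hx).trans_le ?_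
      rw [norm_mul]
      exact mul_le_mul_of_nonneg_right (hC x) (norm_nonneg _))

theorem inner_mulL {m : α → ℝ} (hm : AEStronglyMeasurable m μ) {C : ℝ} (hC : ∀ x, |m x| ≤ C)
    (f g : Lp ℝ 2 μ) : inner ℝ (mulL hm hC f) g = ∫ x, m x * f x * g x ∂μ := by
  rw [inner_Lp]
  refine integral_congr_ae ?_
  filter_upwards [(memLp_mul_of_bound hm hC (Lp.memLp f)).coeFn_toLp] with x hx
  exact congrArg (· * g x) hx

theorem inner_mulL_comm {m : α → ℝ} (hm : AEStronglyMeasurable m μ) {C : ℝ} (hC : ∀ x, |m x| ≤ C)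
    (f g : Lp ℝ 2 μ) : inner ℝ (mulL hm hC f) g = inner ℝ f (mulL hm hC g) := by
  rw [inner_mulL, real_inner_comm, inner_mulL]
  congr 1
  funext x
  ring

end Multiplier

/-- The inner product of triples already contains `∫ U(x,0) V(x,0) dx`, which leaves `k - 1` as the
multiplier of the compact part. -/
theorem form_eq_inner {s T : ℝ} (hs0 : 0 < s) (hs1 : s < 1) {k : ℝ → ℝ}
    (hk : AEStronglyMeasurable (fun x => k x - 1) (volume.restrict (period T))) {C : ℝ}
    (hC : ∀ x, |k x - 1| ≤ C) {U V : HT s T} {u v : Energy s T}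
    (hu : Represents U u.toAmbient) (hv : Represents V v.toAmbient) :
    form k U V = inner ℝ u v + inner ℝ (mulL hk hC (traceL s T u)) (traceL s T v) := by
  rw [inner_mulL]
  have h1 : dConst s * (∫ p in strip T,
      p.2 ^ (1 - 2 * s) * (U.gradX p * V.gradX p + U.gradY p * V.gradY p)) =
      inner ℝ u.toAmbient.fst v.toAmbient.fst +
        inner ℝ u.toAmbient.snd.fst v.toAmbient.snd.fst := by
    rw [inner_Lp, inner_Lp, ← integral_add (integrable_mul_Lp _ _) (integrable_mul_Lp _ _),
      ← integral_const_mul]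
    refine integral_congr_ae ?_
    filter_upwards [hu.gradX, hu.gradY, hv.gradX, hv.gradY,
      ae_restrict_mem (measurableSet_strip T)] with p h1 h2 h3 h4 hp
    rw [h1, h2, h3, h4, ← mul_assoc, ← weight_sq hs0 hs1 (show 0 < p.2 from hp.2)]
    ring
  have h2 : ∫ x in period T, k x * (U.trace : ℝ →ₘ[(volume : Measure ℝ)] ℝ) x *
      (V.trace : ℝ →ₘ[(volume : Measure ℝ)] ℝ) x =
      inner ℝ u.toAmbient.snd.snd v.toAmbient.snd.snd +
        ∫ x in period T, (k x - 1) * traceL s T u x * traceL s T v x := by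
    have h3 : Integrable (fun x => (k x - 1) * traceL s T u x * traceL s T v x)
        (volume.restrict (period T)) :=
      (memLp_mul_of_bound hk hC (Lp.memLp (traceL s T u))).integrable_mul
        (Lp.memLp (traceL s T v))
    rw [inner_Lp, ← integral_add (integrable_mul_Lp _ _) h3]
    refine integral_congr_ae ?_
    have hu3 := coeFn_toL2 U.trace
    have hv3 := coeFn_toL2 V.trace
    rw [← hu.trace] at hu3
    rw [← hv.trace] at hv3
    filter_upwards [hu3, hv3] with x hx1 hx2
    rw [traceL_apply, traceL_apply, hx1, hx2]
    ring
  rw [form, h1, h2, Energy.inner_eq, inner_ambient]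
  ring

/-- The passage between `HT` and the energy space is needed in both directions: once for the
solution, once for the arbitrary test element. -/
theorem isWeakSolution_iff {s T : ℝ} (hs0 : 0 < s) (hs1 : s < 1) (hT : 0 < T) {k : ℝ → ℝ}
    (hk : AEStronglyMeasurable (fun x => k x - 1) (volume.restrict (period T))) {C : ℝ}
    (hC : ∀ x, |k x - 1| ≤ C) (g u : L2T T) :
    IsWeakSolution s T k g u ↔ ∃ w : Energy s T, traceL s T w = toL2 T u ∧
      ∀ v : Energy s T, inner ℝ w v + inner ℝ (mulL hk hC (traceL s T w)) (traceL s T v) =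
        inner ℝ (toL2 T g) (traceL s T v) := by
  constructor
  · rintro ⟨U, rfl, hU⟩
    obtain ⟨w₀, hw₀, hUw⟩ := U.exists_represents hs0 hs1
    obtain ⟨w, rfl⟩ := Energy.exists_toAmbient_eq hw₀
    refine ⟨w, hUw.trace, fun v => ?_⟩
    obtain ⟨V, hV⟩ := exists_HT_represents hs0 hs1 hT v.toAmbient_mem
    rw [traceL_apply v, hV.trace, ← pairing_eq_inner, ← hU V, ← hV.trace]
    exact (form_eq_inner hs0 hs1 hk hC hUw hV).symm
  · rintro ⟨w, hwu, hw⟩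
    obtain ⟨U, hU⟩ := exists_HT_represents hs0 hs1 hT w.toAmbient_mem
    refine ⟨U, toL2_injective hT (hU.trace.symm.trans hwu), fun V => ?_⟩
    obtain ⟨v₀, hv₀, hVv⟩ := V.exists_represents hs0 hs1
    obtain ⟨v, rfl⟩ := Energy.exists_toAmbient_eq hv₀
    rw [form_eq_inner hs0 hs1 hk hC hU hVv, hw, traceL_apply, hVv.trace,
      pairing_eq_inner]

end PeriodicFracLap

/-! ### The Fredholm alternative. -/

open PeriodicFracLap in
theorem theorem2p2 (s T : ℝ) (hs0 : 0 < s) (hs1 : s < 1) (hT : 0 < T)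
    (k : ℝ → ℝ) (hk_meas : AEMeasurable k) (hk_per : Function.Periodic k T)
    (hk_bdd : ∃ M : ℝ, ∀ x, |k x| ≤ M) :
    Xor (∀ g : PeriodicFracLap.L2T T, ∃! u : PeriodicFracLap.L2T T,
            PeriodicFracLap.IsWeakSolution s T k g u)
         (∃ u : PeriodicFracLap.L2T T, u ≠ 0 ∧ PeriodicFracLap.IsWeakSolution s T k 0 u) ∧
    ∃ N : Submodule ℝ (PeriodicFracLap.L2T T),
      (∀ v : PeriodicFracLap.L2T T, v ∈ N ↔ PeriodicFracLap.IsWeakSolution s T k 0 v) ∧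
      FiniteDimensional ℝ N ∧
      ∀ g : PeriodicFracLap.L2T T,
        (∃ u : PeriodicFracLap.L2T T, PeriodicFracLap.IsWeakSolution s T k g u) ↔
          ∀ v ∈ N, PeriodicFracLap.pairing g v = 0 := by
  obtain ⟨M, hM⟩ := hk_bdd
  have hk : AEStronglyMeasurable (fun x => k x - 1) (volume.restrict (period T)) :=
    (hk_meas.restrict.sub_const 1).aestronglyMeasurable
  have hC : ∀ x, |k x - 1| ≤ M + 1 := fun x =>
    (abs_sub _ _).trans (add_le_add (hM x) (abs_one (α := ℝ)).le)
  have hweak : ∀ g u : L2T T, IsWeakSolution s T k g u ↔ ∃ w : Energy s T,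
      traceL s T w = toL2 T u ∧ ∀ v : Energy s T,
        inner ℝ w v + inner ℝ (mulL hk hC (traceL s T w)) (traceL s T v) =
          inner ℝ (toL2 T g) (traceL s T v) :=
    isWeakSolution_iff hs0 hs1 hT hk hC
  obtain ⟨N₀, hfin₀, hN₀, hsolv₀⟩ := exists_fredholm_subspace
    (isCompactOperator_traceL hs0 hs1 hT) (mulL hk hC) (inner_mulL_comm hk hC)
  let e := LinearEquiv.ofBijective (toL2 T) ⟨toL2_injective hT, toL2_surjective hT⟩
  -- The abstract kernel space lives on one period; it is carried back to periodic classes.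
  let N : Submodule ℝ (L2T T) := N₀.map e.symm.toLinearMap
  have hmem : ∀ v : L2T T, v ∈ N ↔ toL2 T v ∈ N₀ := fun v => by
    constructor
    · rintro ⟨f, hf, rfl⟩
      exact (e.apply_symm_apply f).symm ▸ hf
    · exact fun hv => ⟨_, hv, e.symm_apply_apply v⟩
  have hfin : FiniteDimensional ℝ N := inferInstance
  have hN : ∀ v : L2T T, v ∈ N ↔ IsWeakSolution s T k 0 v := fun v => by
    rw [hmem, hN₀, hweak]
    simp only [map_zero, inner_zero_left]
  have hsolv : ∀ g : L2T T, (∃ u : L2T T, IsWeakSolution s T k g u) ↔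
      ∀ v ∈ N, pairing g v = 0 := by
    intro g
    constructor
    · rintro ⟨u, hu⟩ v hv
      obtain ⟨w, -, hw⟩ := (hweak g u).1 hu
      rw [pairing_eq_inner]
      exact (hsolv₀ _).1 ⟨w, hw⟩ _ ((hmem v).1 hv)
    · intro h
      obtain ⟨w, hw⟩ := (hsolv₀ (toL2 T g)).2 fun f hf => by
        obtain ⟨v, rfl⟩ := toL2_surjective hT f
        rw [← pairing_eq_inner]
        exact h v ((hmem v).2 hf)
      obtain ⟨u, hu⟩ := toL2_surjective hT (traceL s T w)
      exact ⟨u, (hweak g u).2 ⟨w, hu.symm, hw⟩⟩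
  refine ⟨?_, N, hN, hfin, hsolv⟩
  have hzero : IsWeakSolution s T k 0 0 := (hN 0).1 (Submodule.zero_mem _)
  by_cases h : ∃ u : L2T T, u ≠ 0 ∧ IsWeakSolution s T k 0 u
  · refine Or.inr ⟨h, fun hi => ?_⟩
    obtain ⟨u, hu0, hu⟩ := h
    exact hu0 ((hi 0).unique hu hzero)
  · refine Or.inl ⟨fun g => ?_, h⟩
    -- With `N` trivial the orthogonality condition is void, which gives existence for every `g`;
    -- two solutions differ by an element of `N`, which gives uniqueness.
    have htriv : ∀ v ∈ N, v = 0 := fun v hv => by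
      by_contra hv0
      exact h ⟨v, hv0, (hN v).1 hv⟩
    obtain ⟨u, hu⟩ := (hsolv g).2 fun v hv => by
      rw [htriv v hv, pairing_eq_inner, map_zero, inner_zero_right]
    refine ⟨u, hu, fun u' hu' => sub_eq_zero.1 (htriv _ ?_)⟩
    obtain ⟨w, hwu, hw⟩ := (hweak g u).1 hu
    obtain ⟨w', hwu', hw'⟩ := (hweak g u').1 hu'
    refine (hN _).2 ((hweak 0 _).2 ⟨w' - w, by rw [map_sub, map_sub, hwu, hwu'], fun v => ?_⟩)
    rw [map_sub, map_sub, inner_sub_left, inner_sub_left, map_zero, inner_zero_left]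
    linarith [hw v, hw' v]
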